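/- Let $\mathbb D=\{z\in\mathbb C:|z|<1\}$. For $z_1,z_2\in\mathbb D$ put $$\varrho_p(z_1,z_2)=\left|\frac{z_1-z_2}{1-\overline{z_1}z_2}\right|,\qquad \varrho_h(z_1,z_2)=\frac12\log\frac{1+\varrho_p(z_1,z_2)}{1-\varrho_p(z_1,z_2)},$$ and let $\xi_h(z_1,z_2)$ be the hyperbolic midpoint of $z_1$ and $z_2$, i.e. the unique point $\xi\in\mathbb D$ with $\varrho_h(z_1,\xi)=\varrho_h(z_2,\xi)=\tfrac12\varrho_h(z_1,z_2)$. For an analytic function $A$ in $\mathbb D$ consider the equation $$f''+Af=0\quad\text{in }\mathbb D. \tag{1}$$ For $0<C<\infty$, let $(\mathrm S_C)$ be the following property of $A$: any two distinct zeros $z_1,z_2\in\mathbb D$ of any non-trivial (i.e. not identically zero) analytic solution $f$ of (1) whose hyperbolic midpoint $\xi=\xi_h(z_1,z_2)$ satisfies $1-|\xi|<1/C$ satisfy $$\varrho_h(z_1,z_2)\ \ge\ \log\frac{2-C^{1/2}(1-|\xi|)^{1/2}}{C^{1/2}(1-|\xi|)^{1/2}}.$$ (i) Let $A$ be analytic in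 $\mathbb D$ and let $0<C<\infty$. If $|A(z)|(1-|z|^2)^2\le 1+C(1-|z|)$ for all $z\in\mathbb D$, then $A$ has property $(\mathrm S_C)$. (ii) Conversely, for every $0<C<\infty$ there is a positive function $\Psi_C$ on $[0,1)$, depending only on $C$, such that $\Psi_C(r)\to 2(8C)^{1/3}$ from above (through values strictly larger than the limit) as $r\to1^-$, and such that every analytic function $A$ in $\mathbb D$ with property $(\mathrm S_C)$ satisfies $$|A(z)|(1-|z|^2)^2\le 3\left(1+\Psi_C(|z|)(1-|z|)^{1/3}\right)\quad\text{for all } z\in\mathbb D \text{ with } 1-|z|<\frac1{8C}.$$ -/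

import Mathlib

open Filter Topology

noncomputable section

namespace Oscillation

/-- The open unit disc of the complex plane. -/
def disc : Set ℂ := Metric.ball (0 : ℂ) 1

/-- The disc automorphism `φ_a(z) = (a - z) / (1 - conj a * z)`, for `a` in the disc. -/
def phi (a z : ℂ) : ℂ := (a - z) / (1 - (starRingEnd ℂ) a * z)

/-- The pseudo-hyperbolic distance between two points of the disc. -/
def pseudoHypDist (z w : ℂ) : ℝ := ‖phi z w‖

/-- The hyperbolic distance between two points of the disc. -/
def hypDist (z w : ℂ) : ℝ :=
  (1 / 2) * Real.log ((1 + pseudoHypDist z w) / (1 - pseudoHypDist z w))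

/-- `ξ` is the hyperbolic midpoint of the points `z₁`, `z₂` of the disc: the (unique) point of the
disc whose hyperbolic distance to each of them is half of their hyperbolic distance. -/
def IsHypMidpoint (z₁ z₂ ξ : ℂ) : Prop :=
  ξ ∈ disc ∧ hypDist z₁ ξ = hypDist z₁ z₂ / 2 ∧ hypDist z₂ ξ = hypDist z₁ z₂ / 2

/-- `f` is a solution, analytic in the disc, of `f'' + A f = 0`. -/
def IsSolution (A f : ℂ → ℂ) : Prop :=
  AnalyticOnNhd ℂ f disc ∧ ∀ z ∈ disc, deriv (deriv f) z + A z * f z = 0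

/-- `f` does not vanish identically in the disc. -/
def NonTrivial (f : ℂ → ℂ) : Prop := ∃ z ∈ disc, f z ≠ 0

/-- Any two distinct zeros of any non-trivial solution of `f'' + A f = 0` whose hyperbolic midpoint
`ξ` satisfies `1 - |ξ| < 1 / C` obey the stated lower bound for their hyperbolic distance. -/
def ZerosSeparated (A : ℂ → ℂ) (C : ℝ) : Prop :=
  ∀ f : ℂ → ℂ, IsSolution A f → NonTrivial f →
    ∀ z₁ ∈ disc, ∀ z₂ ∈ disc, z₁ ≠ z₂ → f z₁ = 0 → f z₂ = 0 →
      ∀ ξ : ℂ, IsHypMidpoint z₁ z₂ ξ → 1 - ‖ξ‖ < 1 / C →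
        Real.log ((2 - Real.sqrt C * Real.sqrt (1 - ‖ξ‖)) /
            (Real.sqrt C * Real.sqrt (1 - ‖ξ‖))) ≤ hypDist z₁ z₂

end Oscillation

end

/-! ### Automorphisms of the disc and the change of variable in the equation. -/

namespace Oscillation

open ComplexConjugate

/-! Both implications rest on conformal invariance. If `g` is `f ∘ phi a` times `1 - conj a * z`,
then `g'' + B g = 0`, where `|B(z)|(1 - |z|²)²` equals `|A|(1 - |·|²)²` at `phi a z`
(`isSolution_pullSol`, `norm_pullCoeff_mul`). Any point of the disc may thus be moved to the origin.

For (i), move the midpoint `ξ` to `0`, so that the zeros become `±u`, and put `s² = C(1 - |ξ|)`. The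
stated lower bound says exactly `|u| ≥ 1 - s`. If `|u| < R < 1 - s`, then on the diameter through
`±u` the growth hypothesis gives `|B(x)| < R²/(R² - x²)²`. The equation with the latter coefficient
has the solution `√(R² - x²)`, positive on `(-R, R)`, so a Riccati argument forces `g` to vanish
between `±u`, hence identically (`eq_zero_of_norm_coeff_lt`, `le_norm_phi_of_zeros`).

For (ii), fix `a` and put `y³ = C(1 - |a|)`. Two distinct zeros in the pseudo-hyperbolic disc of
radius `1 - 2y` about `a` would have their midpoint in it too, which gives `1 - |ξ| ≤ (1 - |a|)/y`
and so `s ≤ y`; separation then contradicts the size of that disc (`not_two_zeros_in_hypBall`).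
After moving `a` to `0`, every non-trivial solution has at most one zero in `|z| < 1 - 2y`. So a
quotient of two independent solutions is univalent there; it expands as `1/z - (B(0)/3) z + ⋯`, and
the area theorem (`norm_deriv_mul_sq_le_one`) yields `|B(0)|(1 - 2y)² ≤ 3`. Writing `x = 2y`, the
identity `1/(1 - x)² = 1 + x(2 - x)/(1 - x)²` produces `Ψ_C`. -/

theorem mem_disc {z : ℂ} : z ∈ disc ↔ ‖z‖ < 1 := by simp [disc]

theorem isOpen_disc : IsOpen disc := Metric.isOpen_ball

theorem one_sub_conj_mul_ne_zero {a z : ℂ} (ha : a ∈ disc) (hz : z ∈ disc) :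
    1 - conj a * z ≠ 0 := by
  rw [mem_disc] at ha hz
  intro h
  have h1 : ‖conj a * z‖ = 1 := by rw [← sub_eq_zero.1 h]; simp
  rw [norm_mul, Complex.norm_conj] at h1
  nlinarith [norm_nonneg a, norm_nonneg z]

theorem normSq_one_sub_conj_mul (a z : ℂ) :
    ‖1 - conj a * z‖ ^ 2 = ‖a - z‖ ^ 2 + (1 - ‖a‖ ^ 2) * (1 - ‖z‖ ^ 2) := by
  simp only [Complex.sq_norm, Complex.normSq_apply, Complex.sub_re, Complex.sub_im, Complex.mul_re,
    Complex.mul_im, Complex.conj_re, Complex.conj_im, Complex.one_re, Complex.one_im]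
  ring

theorem one_sub_norm_phi_sq {a z : ℂ} (ha : a ∈ disc) (hz : z ∈ disc) :
    1 - ‖phi a z‖ ^ 2 = (1 - ‖a‖ ^ 2) * (1 - ‖z‖ ^ 2) / ‖1 - conj a * z‖ ^ 2 := by
  have h : ‖1 - conj a * z‖ ≠ 0 := norm_ne_zero_iff.2 (one_sub_conj_mul_ne_zero ha hz)
  rw [phi, norm_div, div_pow, eq_div_iff (pow_ne_zero 2 h), sub_mul,
    div_mul_cancel₀ _ (pow_ne_zero 2 h), normSq_one_sub_conj_mul]
  ring

theorem phi_mem_disc {a z : ℂ} (ha : a ∈ disc) (hz : z ∈ disc) : phi a z ∈ disc := by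
  have h := one_sub_norm_phi_sq ha hz
  have h0 : 0 < ‖1 - conj a * z‖ := norm_pos_iff.2 (one_sub_conj_mul_ne_zero ha hz)
  rw [mem_disc] at *
  have : 0 < 1 - ‖phi a z‖ ^ 2 := by
    rw [h]
    have h1 : 0 < 1 - ‖a‖ ^ 2 := by nlinarith [norm_nonneg a]
    have h2 : 0 < 1 - ‖z‖ ^ 2 := by nlinarith [norm_nonneg z]
    positivity
  nlinarith [norm_nonneg (phi a z)]

theorem one_sub_conj_mul_self (a : ℂ) : 1 - conj a * a = ((1 - ‖a‖ ^ 2 : ℝ) : ℂ) := by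
  rw [Complex.conj_mul']; push_cast; rfl

theorem one_sub_conj_mul_self_ne_zero {a : ℂ} (ha : a ∈ disc) : 1 - conj a * a ≠ 0 :=
  one_sub_conj_mul_ne_zero ha ha

theorem one_sub_conj_mul_phi {a w : ℂ} (ha : a ∈ disc) (hw : w ∈ disc) :
    1 - conj a * phi a w = (1 - conj a * a) / (1 - conj a * w) := by
  have h := one_sub_conj_mul_ne_zero ha hw
  rw [phi]
  field_simp
  ring

theorem phi_phi {a w : ℂ} (ha : a ∈ disc) (hw : w ∈ disc) : phi a (phi a w) = w := by
  have h := one_sub_conj_mul_ne_zero ha hw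
  have h' := one_sub_conj_mul_self_ne_zero ha
  rw [phi, one_sub_conj_mul_phi ha hw, phi]
  generalize hd : 1 - conj a * w = d at *
  generalize hk : 1 - conj a * a = k at *
  field_simp
  rw [← hd, ← hk]
  ring

@[simp] theorem phi_zero (a : ℂ) : phi a 0 = a := by simp [phi]

theorem zero_mem_disc : (0 : ℂ) ∈ disc := by simp [mem_disc]

theorem neg_mem_disc {u : ℂ} (hu : u ∈ disc) : -u ∈ disc := by
  rw [mem_disc] at *; simpa using hu

theorem norm_phi_comm (a z : ℂ) : ‖phi a z‖ = ‖phi z a‖ := by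
  have : ‖1 - conj a * z‖ = ‖1 - conj z * a‖ := by
    rw [← Complex.norm_conj]; simp [mul_comm]
  rw [phi, phi, norm_div, norm_div, this, norm_sub_rev]

/-- Composition of disc automorphisms, up to a unimodular constant. -/
theorem phi_phi_phi {a m w : ℂ} (ha : a ∈ disc) (hm : m ∈ disc) (hw : w ∈ disc) :
    phi (phi a m) (phi a w) = -((1 - a * conj m) / (1 - conj a * m)) * phi m w := by
  have h1 := one_sub_conj_mul_ne_zero ha hw
  have h2 := one_sub_conj_mul_ne_zero ha hm
  have h3 := one_sub_conj_mul_ne_zero hm hw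
  have h4 := one_sub_conj_mul_self_ne_zero ha
  have h5 : 1 - a * conj m ≠ 0 := by
    rw [mul_comm]; exact one_sub_conj_mul_ne_zero hm ha
  have hnum : phi a m - phi a w
      = (w - m) * (1 - conj a * a) / ((1 - conj a * m) * (1 - conj a * w)) := by
    rw [phi, phi, div_sub_div _ _ h2 h1]
    congr 1
    ring
  have hden : 1 - conj (phi a m) * phi a w
      = (1 - conj a * a) * (1 - conj m * w) / ((1 - a * conj m) * (1 - conj a * w)) := by
    rw [phi, phi]
    simp only [map_div₀, map_sub, map_mul, Complex.conj_conj, map_one]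
    rw [div_mul_div_comm, eq_div_iff (mul_ne_zero h5 h1), sub_mul,
      div_mul_cancel₀ _ (mul_ne_zero h5 h1)]
    ring
  rw [phi, hnum, hden, phi]
  generalize 1 - conj a * w = d at *
  generalize 1 - conj a * a = k at *
  generalize 1 - conj a * m = e at *
  generalize 1 - a * conj m = e' at *
  generalize 1 - conj m * w = d' at *
  field_simp
  ring

theorem norm_unimodular {a m : ℂ} (ha : a ∈ disc) (hm : m ∈ disc) :
    ‖(1 - a * conj m) / (1 - conj a * m)‖ = 1 := by
  have h2 := one_sub_conj_mul_ne_zero ha hm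
  have : ‖1 - a * conj m‖ = ‖1 - conj a * m‖ := by
    rw [← Complex.norm_conj]; simp
  rw [norm_div, this, div_self (norm_ne_zero_iff.2 h2)]

theorem norm_phi_phi_phi {a m w : ℂ} (ha : a ∈ disc) (hm : m ∈ disc) (hw : w ∈ disc) :
    ‖phi (phi a m) (phi a w)‖ = ‖phi m w‖ := by
  rw [phi_phi_phi ha hm hw, norm_mul, norm_neg, norm_unimodular ha hm, one_mul]

/-- Since `|1 - conj a * b| ≥ 1 - |a||b|`, the distance `‖phi a b‖` is at least that of the moduli.
It controls how fast the distance to the boundary can change within a hyperbolic disc. -/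
theorem one_sub_norm_phi_le {a b : ℂ} (ha : a ∈ disc) (hb : b ∈ disc) :
    1 - ‖phi a b‖ ≤ (1 - ‖a‖) * (1 + ‖b‖) / (1 - ‖b‖) := by
  have h := one_sub_norm_phi_sq ha hb
  have hd := norm_pos_iff.2 (one_sub_conj_mul_ne_zero ha hb)
  have hlow : 1 - ‖a‖ * ‖b‖ ≤ ‖1 - conj a * b‖ := by
    have := norm_sub_norm_le (1 : ℂ) (conj a * b)
    simpa using this
  rw [mem_disc] at ha hb
  set x := ‖a‖
  set y := ‖b‖
  have hx : 0 ≤ x := norm_nonneg a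
  have hy : 0 ≤ y := norm_nonneg b
  set q := ‖phi a b‖
  have hq : 0 ≤ q := norm_nonneg _
  set D := ‖1 - conj a * b‖
  have hxy : 0 < 1 - x * y := by nlinarith
  have h1 : 1 - q ^ 2 ≤ (1 - x ^ 2) * (1 - y ^ 2) / (1 - x * y) ^ 2 := by
    rw [h]
    have : 0 ≤ (1 - x ^ 2) * (1 - y ^ 2) := by
      apply mul_nonneg <;> nlinarith
    gcongr
  have h2 : ((x - y) / (1 - x * y)) ^ 2 ≤ q ^ 2 := by
    have : ((x - y) / (1 - x * y)) ^ 2 = 1 - (1 - x ^ 2) * (1 - y ^ 2) / (1 - x * y) ^ 2 := by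
      field_simp; ring
    linarith
  have h3 : (x - y) / (1 - x * y) ≤ q := (abs_le_of_sq_le_sq' h2 hq).2
  calc 1 - q ≤ 1 - (x - y) / (1 - x * y) := by linarith
    _ = (1 - x) * (1 + y) / (1 - x * y) := by field_simp; ring
    _ ≤ (1 - x) * (1 + y) / (1 - y) := by
      have : 0 ≤ (1 - x) * (1 + y) := by apply mul_nonneg <;> linarith
      have : 1 - y ≤ 1 - x * y := by nlinarith
      have : 0 < 1 - y := by linarith
      gcongr

theorem hasDerivAt_one_sub_conj_mul (a z : ℂ) :
    HasDerivAt (fun w => 1 - conj a * w) (-conj a) z := by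
  simpa using ((hasDerivAt_id z).const_mul (conj a)).const_sub 1

theorem hasDerivAt_phi {a z : ℂ} (ha : a ∈ disc) (hz : z ∈ disc) :
    HasDerivAt (phi a) (-(1 - conj a * a) / (1 - conj a * z) ^ 2) z := by
  have h := one_sub_conj_mul_ne_zero ha hz
  have h1 : HasDerivAt (fun w => a - w) (-1) z := by
    simpa using (hasDerivAt_id z).const_sub a
  have := h1.div (hasDerivAt_one_sub_conj_mul a z) h
  refine this.congr_deriv ?_
  congr 1
  ring

/-- The coefficient of the equation obtained from `f'' + A f = 0` by the change of variable
`phi a`. -/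
noncomputable def pullCoeff (A : ℂ → ℂ) (a z : ℂ) : ℂ :=
  A (phi a z) * (1 - conj a * a) ^ 2 / (1 - conj a * z) ^ 4

/-- The change of variable `phi a` applied to a solution of `f'' + A f = 0`. -/
noncomputable def pullSol (f : ℂ → ℂ) (a z : ℂ) : ℂ := f (phi a z) * (1 - conj a * z)

theorem norm_pullCoeff_mul {A : ℂ → ℂ} {a z : ℂ} (ha : a ∈ disc) (hz : z ∈ disc) :
    ‖pullCoeff A a z‖ * (1 - ‖z‖ ^ 2) ^ 2 = ‖A (phi a z)‖ * (1 - ‖phi a z‖ ^ 2) ^ 2 := by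
  have h := norm_pos_iff.2 (one_sub_conj_mul_ne_zero ha hz)
  have hn : ‖1 - conj a * a‖ ^ 2 = (1 - ‖a‖ ^ 2) ^ 2 := by
    rw [one_sub_conj_mul_self, Complex.norm_real, Real.norm_eq_abs, sq_abs]
  rw [one_sub_norm_phi_sq ha hz, pullCoeff, norm_div, norm_mul, norm_pow, norm_pow, hn]
  field_simp

theorem pullCoeff_pullCoeff {A : ℂ → ℂ} {a z : ℂ} (ha : a ∈ disc) (hz : z ∈ disc) :
    pullCoeff (pullCoeff A a) a z = A z := by
  have h := one_sub_conj_mul_ne_zero ha hz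
  have h' := one_sub_conj_mul_self_ne_zero ha
  rw [pullCoeff, pullCoeff, phi_phi ha hz, one_sub_conj_mul_phi ha hz]
  field_simp

theorem analyticOnNhd_pullCoeff {A : ℂ → ℂ} (hA : AnalyticOnNhd ℂ A disc) {a : ℂ}
    (ha : a ∈ disc) : AnalyticOnNhd ℂ (pullCoeff A a) disc := by
  refine DifferentiableOn.analyticOnNhd (fun z hz => ?_) isOpen_disc
  have h1 : DifferentiableAt ℂ (fun z => A (phi a z)) z :=
    (hA _ (phi_mem_disc ha hz)).differentiableAt.comp z (hasDerivAt_phi ha hz).differentiableAt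
  have h2 := (hasDerivAt_one_sub_conj_mul a z).differentiableAt
  exact ((h1.mul_const _).div (h2.pow 4)
    (pow_ne_zero 4 (one_sub_conj_mul_ne_zero ha hz))).differentiableWithinAt

/-- Up to a constant, `1 - conj a * z` is `(phi a)'` to the power `-1/2`, the factor that removes
the first-order term. No further potential appears because a Möbius map has zero Schwarzian
derivative. -/
theorem isSolution_pullSol {A f : ℂ → ℂ} (hf : IsSolution A f) {a : ℂ} (ha : a ∈ disc) :
    IsSolution (pullCoeff A a) (pullSol f a) := by
  obtain ⟨hfa, hfe⟩ := hf
  have hd : ∀ z ∈ disc, HasDerivAt (pullSol f a)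
      (deriv f (phi a z) * (-(1 - conj a * a) / (1 - conj a * z)) + f (phi a z) * (-conj a)) z := by
    intro z hz
    have h := one_sub_conj_mul_ne_zero ha hz
    have h1 := ((hfa _ (phi_mem_disc ha hz)).differentiableAt.hasDerivAt.comp z
      (hasDerivAt_phi ha hz)).mul (hasDerivAt_one_sub_conj_mul a z)
    refine h1.congr_deriv ?_
    dsimp only [Function.comp_apply]
    generalize 1 - conj a * z = d at *
    field_simp
  have hd2 : ∀ z ∈ disc, HasDerivAt (deriv (pullSol f a))
      (deriv (deriv f) (phi a z) * (1 - conj a * a) ^ 2 / (1 - conj a * z) ^ 3) z := by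
    intro z hz
    have h := one_sub_conj_mul_ne_zero ha hz
    have hp := phi_mem_disc ha hz
    have h1 := ((hfa.deriv _ hp).differentiableAt.hasDerivAt.comp z (hasDerivAt_phi ha hz)).mul
      ((hasDerivAt_const z (-(1 - conj a * a))).div (hasDerivAt_one_sub_conj_mul a z) h)
    have h2 := ((hfa _ hp).differentiableAt.hasDerivAt.comp z (hasDerivAt_phi ha hz)).mul_const
      (-conj a)
    refine ((h1.add h2).congr_of_eventuallyEq ?_).congr_deriv ?_
    · filter_upwards [isOpen_disc.mem_nhds hz] with w hw
      simpa using (hd w hw).deriv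
    · simp only [Function.comp_apply, Pi.div_apply]
      generalize 1 - conj a * z = d at *
      generalize 1 - conj a * a = k at *
      field_simp
      ring
  refine ⟨DifferentiableOn.analyticOnNhd
    (fun z hz => (hd z hz).differentiableAt.differentiableWithinAt) isOpen_disc, fun z hz => ?_⟩
  have h := one_sub_conj_mul_ne_zero ha hz
  have he := hfe _ (phi_mem_disc ha hz)
  rw [(hd2 z hz).deriv, eq_neg_of_add_eq_zero_left he, pullCoeff, pullSol]
  field_simp
  ring

theorem nonTrivial_pullSol {f : ℂ → ℂ} (hf : NonTrivial f) {a : ℂ} (ha : a ∈ disc) :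
    NonTrivial (pullSol f a) := by
  obtain ⟨z, hz, h⟩ := hf
  refine ⟨phi a z, phi_mem_disc ha hz, ?_⟩
  rw [pullSol, phi_phi ha hz]
  exact mul_ne_zero h (one_sub_conj_mul_ne_zero ha (phi_mem_disc ha hz))

/-! ### Hyperbolic midpoints -/

theorem norm_phi_neg {u : ℂ} : ‖phi u (-u)‖ = 2 * ‖u‖ / (1 + ‖u‖ ^ 2) := by
  have h1 : 1 - conj u * -u = ((1 + ‖u‖ ^ 2 : ℝ) : ℂ) := by
    rw [mul_neg, Complex.conj_mul']; push_cast; ring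
  have h2 : u - -u = 2 * u := by ring
  rw [phi, h1, h2, norm_div, norm_mul, Complex.norm_real, Real.norm_eq_abs,
    abs_of_pos (by positivity)]
  simp

/-- The doubling formula for `tanh`, in the form matching `norm_phi_neg`. -/
theorem log_double {t : ℝ} (h1 : t < 1) :
    Real.log ((1 + 2 * t / (1 + t ^ 2)) / (1 - 2 * t / (1 + t ^ 2)))
      = 2 * Real.log ((1 + t) / (1 - t)) := by
  have h2 : 0 < 1 - t := by linarith
  have h3 : (1 + 2 * t / (1 + t ^ 2)) / (1 - 2 * t / (1 + t ^ 2)) = ((1 + t) / (1 - t)) ^ 2 := by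
    have h4 : (1 + t ^ 2 - 2 * t) ≠ 0 := by
      have : 1 + t ^ 2 - 2 * t = (1 - t) ^ 2 := by ring
      rw [this]; positivity
    field_simp
    ring
  rw [h3, Real.log_pow]
  norm_num

theorem log_ratio_strictMonoOn :
    StrictMonoOn (fun t : ℝ => Real.log ((1 + t) / (1 - t))) (Set.Ico 0 1) := by
  intro x hx y hy hxy
  have hx1 : 0 < 1 - x := by linarith [hx.2]
  have hy1 : 0 < 1 - y := by linarith [hy.2]
  refine Real.log_lt_log (div_pos (by linarith [hx.1]) hx1) ?_
  rw [div_lt_div_iff₀ hx1 hy1]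
  nlinarith

/-- If the automorphism `phi ξ` takes `z₁`, `z₂` to opposite points, the hyperbolic distance of
`z₁` and `z₂` is twice their distance to `ξ`. -/
theorem hypDist_of_phi_eq_neg {z₁ z₂ ξ : ℂ} (h₁ : z₁ ∈ disc) (h₂ : z₂ ∈ disc) (hξ : ξ ∈ disc)
    (h : phi ξ z₂ = -phi ξ z₁) :
    hypDist z₁ z₂ = Real.log ((1 + ‖phi ξ z₁‖) / (1 - ‖phi ξ z₁‖)) := by
  have hm := mem_disc.1 (phi_mem_disc hξ h₁)
  have : ‖phi z₁ z₂‖ = 2 * ‖phi ξ z₁‖ / (1 + ‖phi ξ z₁‖ ^ 2) := by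
    rw [← norm_phi_neg, ← h, norm_phi_phi_phi hξ h₁ h₂]
  rw [hypDist, pseudoHypDist, this, log_double hm]
  ring

theorem isHypMidpoint_of_phi_eq_neg {z₁ z₂ ξ : ℂ} (h₁ : z₁ ∈ disc) (h₂ : z₂ ∈ disc)
    (hξ : ξ ∈ disc) (h : phi ξ z₂ = -phi ξ z₁) : IsHypMidpoint z₁ z₂ ξ := by
  refine ⟨hξ, ?_, ?_⟩
  · rw [hypDist_of_phi_eq_neg h₁ h₂ hξ h, hypDist, pseudoHypDist, norm_phi_comm]; ring
  · rw [hypDist_of_phi_eq_neg h₁ h₂ hξ h, hypDist, pseudoHypDist, norm_phi_comm, h, norm_neg]; ring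

/-- The images `u`, `v` of the two points have equal modulus `t`, and their pseudo-hyperbolic
distance `2t/(1 + t²)` forces `|u - v| = 2t`. The parallelogram law then gives `u + v = 0`. -/
theorem phi_eq_neg_of_isHypMidpoint {z₁ z₂ ξ : ℂ} (h₁ : z₁ ∈ disc) (h₂ : z₂ ∈ disc)
    (h : IsHypMidpoint z₁ z₂ ξ) : phi ξ z₂ = -phi ξ z₁ := by
  obtain ⟨hξ, e1, e2⟩ := h
  have hu := mem_disc.1 (phi_mem_disc hξ h₁)
  have hv := mem_disc.1 (phi_mem_disc hξ h₂)
  have hτ := mem_disc.1 (phi_mem_disc h₁ h₂)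
  have inv := norm_phi_phi_phi hξ h₁ h₂
  have sq := normSq_one_sub_conj_mul (phi ξ z₁) (phi ξ z₂)
  have hD := norm_pos_iff.2 (one_sub_conj_mul_ne_zero (phi_mem_disc hξ h₁) (phi_mem_disc hξ h₂))
  rw [hypDist, hypDist, pseudoHypDist, pseudoHypDist, norm_phi_comm] at e1 e2
  set u := phi ξ z₁
  set v := phi ξ z₂
  set t := ‖u‖
  have ht : 0 ≤ t := norm_nonneg u
  have huv : ‖v‖ = t :=
    log_ratio_strictMonoOn.injOn ⟨norm_nonneg _, hv⟩ ⟨ht, hu⟩ (by linarith)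
  have hlt : 2 * t / (1 + t ^ 2) < 1 := by
    rw [div_lt_one (by positivity)]; nlinarith
  have hττ : ‖phi z₁ z₂‖ = 2 * t / (1 + t ^ 2) := by
    refine log_ratio_strictMonoOn.injOn ⟨norm_nonneg _, hτ⟩ ⟨by positivity, hlt⟩ ?_
    rw [log_double hu]
    linarith
  rw [hττ, phi, norm_div, div_eq_div_iff hD.ne' (by positivity)] at inv
  rw [huv] at sq
  have hd : ‖u - v‖ ^ 2 = 4 * t ^ 2 := by
    have h3 : (‖u - v‖ * (1 + t ^ 2)) ^ 2 = (2 * t) ^ 2 * ‖1 - conj u * v‖ ^ 2 := by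
      rw [inv]; ring
    rw [sq] at h3
    have h4 : (1 - t ^ 2) ^ 2 * (‖u - v‖ ^ 2 - 4 * t ^ 2) = 0 := by linear_combination h3
    have h5 : (1 - t ^ 2) ≠ 0 := by nlinarith
    have := (mul_eq_zero.1 h4).resolve_left (pow_ne_zero 2 h5)
    linarith
  have hp := parallelogram_law_with_norm ℝ u v
  have h6 : ‖u + v‖ = 0 := by
    have : ‖u + v‖ * ‖u + v‖ = 0 := by rw [huv] at hp; nlinarith
    simpa using this
  exact eq_neg_of_add_eq_zero_right (norm_eq_zero.1 h6)

theorem exists_phi_eq_neg {z₁ z₂ : ℂ} (h₁ : z₁ ∈ disc) (h₂ : z₂ ∈ disc) :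
    ∃ ξ ∈ disc, phi ξ z₂ = -phi ξ z₁ := by
  set q := phi z₁ z₂ with hq
  have hqd : q ∈ disc := phi_mem_disc h₁ h₂
  have hq1 := mem_disc.1 hqd
  set S := Real.sqrt (1 - ‖q‖ ^ 2) with hS
  have hpos : 0 ≤ 1 - ‖q‖ ^ 2 := by nlinarith [norm_nonneg q]
  have hS2 : S ^ 2 = 1 - ‖q‖ ^ 2 := Real.sq_sqrt hpos
  have hS0 : 0 ≤ S := Real.sqrt_nonneg _
  -- `m` is the midpoint of `0` and `q`: it solves `2|m|/(1 + |m|²) = |q|` on the ray through `q`.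
  -- Applying `phi z₁` carries it to the midpoint of `z₁` and `z₂`.
  set m : ℂ := q / ((1 + S : ℝ) : ℂ) with hm
  have hSc : ((1 + S : ℝ) : ℂ) ≠ 0 := by
    exact_mod_cast (by positivity : (1 + S) ≠ 0)
  have hqm : q = ((1 + S : ℝ) : ℂ) * m := by rw [hm]; field_simp
  have hmn : ‖m‖ = ‖q‖ / (1 + S) := by
    rw [hm, norm_div, Complex.norm_real, Real.norm_eq_abs, abs_of_nonneg (by positivity)]
  have hmd : m ∈ disc := by
    rw [mem_disc, hmn, div_lt_one (by positivity)]; linarith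
  have hmm : conj m * q = ((1 - S : ℝ) : ℂ) := by
    have h3 : conj m * q = ((‖q‖ ^ 2 / (1 + S) : ℝ) : ℂ) := by
      rw [hm, map_div₀, Complex.conj_ofReal, div_mul_eq_mul_div, Complex.conj_mul']
      push_cast; rfl
    rw [h3]
    congr 1
    rw [div_eq_iff (by positivity)]
    nlinarith
  have hφ : phi m q = -m := by
    have hd := one_sub_conj_mul_ne_zero hmd hqd
    rw [phi, div_eq_iff hd, hmm]
    nth_rewrite 1 [hqm]
    push_cast
    ring
  refine ⟨phi z₁ m, phi_mem_disc h₁ hmd, ?_⟩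
  have e1 := phi_phi_phi h₁ hmd hqd
  have e2 := phi_phi_phi h₁ hmd zero_mem_disc
  rw [hq, phi_phi h₁ h₂, ← hq, hφ] at e1
  rw [phi_zero, phi_zero] at e2
  rw [e1, e2]
  ring

/-- Hyperbolic discs are hyperbolically convex, and half of the distance of two points of a
hyperbolic disc is less than its radius. -/
theorem midpoint_mem_hypBall {z₁ z₂ ξ a : ℂ} {ρ : ℝ} (h₁ : z₁ ∈ disc) (h₂ : z₂ ∈ disc)
    (hξ : ξ ∈ disc) (ha : a ∈ disc) (h : phi ξ z₂ = -phi ξ z₁) (hρ : ρ < 1)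
    (d₁ : ‖phi a z₁‖ < ρ) (d₂ : ‖phi a z₂‖ < ρ) : ‖phi a ξ‖ < ρ ∧ ‖phi ξ z₁‖ < ρ := by
  have hc := phi_mem_disc hξ ha
  have hu := phi_mem_disc hξ h₁
  have hv := phi_mem_disc hξ h₂
  rw [← norm_phi_phi_phi hξ ha h₁] at d₁
  rw [← norm_phi_phi_phi hξ ha h₂, h] at d₂
  rw [norm_phi_comm a ξ]
  have s1 := one_sub_norm_phi_sq hc hu
  have s2 := one_sub_norm_phi_sq hc (neg_mem_disc hu)
  set c := phi ξ a
  set u := phi ξ z₁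
  have p1 := norm_pos_iff.2 (one_sub_conj_mul_ne_zero hc hu)
  have p2 := norm_pos_iff.2 (one_sub_conj_mul_ne_zero hc (neg_mem_disc hu))
  have hρ0 : 0 < ρ := (norm_nonneg _).trans_lt d₁
  rw [eq_div_iff (by positivity)] at s1 s2
  rw [norm_neg] at s2
  -- With `ξ` at the origin the points are `±u`. Clearing denominators in both distance bounds and
  -- adding them cancels the cross terms; both conclusions follow from the sum.
  have par : ‖1 - conj c * u‖ ^ 2 + ‖1 - conj c * -u‖ ^ 2 = 2 + 2 * (‖c‖ ^ 2 * ‖u‖ ^ 2) := by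
    have := parallelogram_law_with_norm ℝ 1 (conj c * u)
    rw [norm_mul, Complex.norm_conj, norm_one] at this
    rw [mul_neg, sub_neg_eq_add]
    linarith
  have q1 : 1 - ρ ^ 2 < 1 - ‖phi c u‖ ^ 2 := by nlinarith [norm_nonneg (phi c u)]
  have q2 : 1 - ρ ^ 2 < 1 - ‖phi c (-u)‖ ^ 2 := by nlinarith [norm_nonneg (phi c (-u))]
  have r1 := mul_lt_mul_of_pos_right q1 (pow_pos p1 2)
  have r2 := mul_lt_mul_of_pos_right q2 (pow_pos p2 2)
  have key : (1 - ρ ^ 2) * (1 + ‖c‖ ^ 2 * ‖u‖ ^ 2) < (1 - ‖c‖ ^ 2) * (1 - ‖u‖ ^ 2) := by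
    have h3 : (1 - ρ ^ 2) * (‖1 - conj c * u‖ ^ 2 + ‖1 - conj c * -u‖ ^ 2)
        < 2 * ((1 - ‖c‖ ^ 2) * (1 - ‖u‖ ^ 2)) := by linarith
    rw [par] at h3
    linarith
  have hρ2 : 0 < 1 - ρ ^ 2 := by nlinarith
  have n1 : 0 ≤ (1 - ρ ^ 2) * (‖c‖ ^ 2 * ‖u‖ ^ 2) := by positivity
  have hc1 := mem_disc.1 hc
  have hu1 := mem_disc.1 hu
  have c2 : 0 ≤ 1 - ‖c‖ ^ 2 := by nlinarith [norm_nonneg c]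
  have u2 : 0 ≤ 1 - ‖u‖ ^ 2 := by nlinarith [norm_nonneg u]
  constructor
  · refine lt_of_pow_lt_pow_left₀ 2 hρ0.le ?_
    nlinarith [mul_nonneg c2 (sq_nonneg ‖u‖)]
  · refine lt_of_pow_lt_pow_left₀ 2 hρ0.le ?_
    nlinarith [mul_nonneg u2 (sq_nonneg ‖c‖)]

end Oscillation

/-! ### Disconjugacy on a diameter, and the separation of zeros. -/

namespace Oscillation

open ComplexConjugate

/-- A comparison principle: the equation `G'' + q G = 0` is disconjugate if
`|q(x)| < R² / (R² - x²)²`. -/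
theorem eq_zero_of_norm_coeff_lt {R t : ℝ} (ht : 0 < t) (htR : t < R) {G G' q : ℝ → ℂ}
    (h1 : ∀ x ∈ Set.Icc (-t) t, HasDerivAt G (G' x) x)
    (h2 : ∀ x ∈ Set.Icc (-t) t, HasDerivAt G' (-(q x * G x)) x)
    (hq : ∀ x ∈ Set.Icc (-t) t, ‖q x‖ < R ^ 2 / (R ^ 2 - x ^ 2) ^ 2)
    (hl : G (-t) = 0) (hr : G t = 0) : ∀ x ∈ Set.Ioo (-t) t, G x = 0 := by
  have hpos : ∀ x ∈ Set.Icc (-t) t, 0 < R ^ 2 - x ^ 2 := by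
    intro x hx
    nlinarith [hx.1, hx.2]
  -- The Riccati weight `x / (R² - x²)` is `-y'/y` for the comparison solution `y = √(R² - x²)`.
  -- Completing the square gives `F' ≥ |G|² (R²/(R² - x²)² - |q|)`, and `F` vanishes at `±t`.
  set F : ℝ → ℝ := fun x => inner ℝ (G x) (G' x) + ‖G x‖ ^ 2 * (x / (R ^ 2 - x ^ 2)) with hF
  have hder : ∀ x ∈ Set.Icc (-t) t, ∃ F', HasDerivAt F F' x ∧
      ‖G x‖ ^ 2 * (R ^ 2 / (R ^ 2 - x ^ 2) ^ 2 - ‖q x‖) ≤ F' := by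
    intro x hx
    have hp := hpos x hx
    have hw : HasDerivAt (fun x : ℝ => x / (R ^ 2 - x ^ 2))
        ((R ^ 2 + x ^ 2) / (R ^ 2 - x ^ 2) ^ 2) x := by
      refine ((hasDerivAt_id x).div ((hasDerivAt_pow 2 x).const_sub (R ^ 2)) hp.ne').congr_deriv ?_
      congr 1
      simp
      ring
    refine ⟨_, ((h1 x hx).inner ℝ (h2 x hx)).add ((h1 x hx).norm_sq.mul hw), ?_⟩
    have hcs : -(‖q x‖ * ‖G x‖ ^ 2) ≤ inner ℝ (G x) (-(q x * G x)) := by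
      rw [inner_neg_right, neg_le_neg_iff]
      calc inner ℝ (G x) (q x * G x) ≤ ‖G x‖ * ‖q x * G x‖ := real_inner_le_norm _ _
        _ = ‖q x‖ * ‖G x‖ ^ 2 := by rw [norm_mul]; ring
    have hsq : 0 ≤ ‖G' x + (x / (R ^ 2 - x ^ 2)) • G x‖ ^ 2 := sq_nonneg _
    rw [norm_add_sq_real, norm_smul, mul_pow, Real.norm_eq_abs, sq_abs, inner_smul_right,
      real_inner_comm] at hsq
    rw [real_inner_self_eq_norm_sq]
    have he : (R ^ 2 + x ^ 2) / (R ^ 2 - x ^ 2) ^ 2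
        = R ^ 2 / (R ^ 2 - x ^ 2) ^ 2 + (x / (R ^ 2 - x ^ 2)) ^ 2 := by
      rw [div_pow, add_div]
    rw [he]
    linarith
  have hmono : MonotoneOn F (Set.Icc (-t) t) := by
    refine monotoneOn_of_deriv_nonneg (convex_Icc _ _) (fun x hx => ?_) (fun x hx => ?_)
      (fun x hx => ?_)
    · obtain ⟨F', h, -⟩ := hder x hx
      exact h.continuousAt.continuousWithinAt
    · obtain ⟨F', h, -⟩ := hder x (interior_subset hx)
      exact h.differentiableAt.differentiableWithinAt
    · obtain ⟨F', h, h'⟩ := hder x (interior_subset hx)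
      rw [h.deriv]
      refine le_trans (mul_nonneg (sq_nonneg _) ?_) h'
      linarith [hq x (interior_subset hx)]
  have hzero : ∀ x ∈ Set.Icc (-t) t, F x = 0 := by
    intro x hx
    have e1 := hmono ⟨le_rfl, by linarith⟩ hx hx.1
    have e2 := hmono hx ⟨by linarith, le_rfl⟩ hx.2
    have l0 : F (-t) = 0 := by simp [hF, hl]
    have r0 : F t = 0 := by simp [hF, hr]
    exact le_antisymm (e2.trans_eq r0) (l0.symm.trans_le e1)
  intro x hx
  obtain ⟨F', h, h'⟩ := hder x (Set.Ioo_subset_Icc_self hx)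
  have hF0 : F' = 0 := by
    have : F =ᶠ[𝓝 x] fun _ => 0 := by
      filter_upwards [Ioo_mem_nhds hx.1 hx.2] with y hy
      exact hzero y (Set.Ioo_subset_Icc_self hy)
    exact h.unique ((hasDerivAt_const x (0 : ℝ)).congr_of_eventuallyEq this)
  have hq' := hq x (Set.Ioo_subset_Icc_self hx)
  by_contra hne
  have : 0 < ‖G x‖ := norm_pos_iff.2 hne
  have := mul_pos (pow_pos this 2) (sub_pos.2 hq')
  linarith

/-- `K` plays the role of `C(1 - |ξ|)`. After clearing denominators, the factor `(R² - t²)²` is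
split: `a3` absorbs the perturbation `K` with one copy, and `a1` handles the other. -/
theorem comparison_inequality {K R t : ℝ} (hK : 0 < K) (ht : 0 ≤ t) (htR : t < R) (hR : R < 1)
    (hKR : K < (1 - R) ^ 2) :
    (1 + K * ((1 + t) / (1 - t))) / (1 - t ^ 2) ^ 2 < R ^ 2 / (R ^ 2 - t ^ 2) ^ 2 := by
  have h1 : 0 < 1 - t := by linarith
  have h2 : 0 < 1 - t ^ 2 := by nlinarith
  have h3 : 0 < R ^ 2 - t ^ 2 := by nlinarith
  have hRp : 0 < R := by linarith
  have a1 : R ^ 2 - t ^ 2 ≤ R ^ 2 * (1 - t ^ 2) := by 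
    have : R ^ 2 * t ^ 2 ≤ 1 * t ^ 2 := by gcongr; nlinarith
    linarith
  have a2 : K * (1 + t) * (R ^ 2 - t ^ 2) < (1 - R ^ 2) * (1 - t) := by
    have b1 : (1 - R) * (1 + t) * (R + t) ≤ 1 + R := by
      have : (1 - R) * (1 + t) * (R + t) ≤ (1 - R) * (1 + R) * (R + R) := by
        have : 0 ≤ 1 - R := by linarith
        gcongr
      nlinarith [sq_nonneg (2 * R - 1)]
    calc K * (1 + t) * (R ^ 2 - t ^ 2) < (1 - R) ^ 2 * (1 + t) * (R ^ 2 - t ^ 2) := by gcongr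
      _ = ((1 - R) * (1 + t) * (R + t)) * ((1 - R) * (R - t)) := by ring
      _ ≤ (1 + R) * ((1 - R) * (1 - t)) := by
        have : 0 ≤ R - t := by linarith
        have : 0 ≤ 1 - R := by linarith
        have : 0 ≤ 1 + R := by linarith
        gcongr
      _ = (1 - R ^ 2) * (1 - t) := by ring
  have a3 : (1 - t + K * (1 + t)) * (R ^ 2 - t ^ 2) < (1 - t ^ 2) * (1 - t) := by nlinarith
  rw [div_lt_div_iff₀ (by positivity) (by positivity)]
  have e : 1 + K * ((1 + t) / (1 - t)) = (1 - t + K * (1 + t)) / (1 - t) := by field_simp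
  rw [e, div_mul_eq_mul_div, div_lt_iff₀ h1]
  calc (1 - t + K * (1 + t)) * (R ^ 2 - t ^ 2) ^ 2
      = ((1 - t + K * (1 + t)) * (R ^ 2 - t ^ 2)) * (R ^ 2 - t ^ 2) := by ring
    _ < ((1 - t ^ 2) * (1 - t)) * (R ^ 2 - t ^ 2) := by gcongr
    _ ≤ ((1 - t ^ 2) * (1 - t)) * (R ^ 2 * (1 - t ^ 2)) := by gcongr
    _ = R ^ 2 * (1 - t ^ 2) ^ 2 * (1 - t) := by ring

theorem le_norm_phi_of_zeros {A f : ℂ → ℂ} {C : ℝ} (hC : 0 < C)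
    (hA : ∀ z ∈ disc, ‖A z‖ * (1 - ‖z‖ ^ 2) ^ 2 ≤ 1 + C * (1 - ‖z‖))
    (hf : IsSolution A f) (hn : NonTrivial f) {z₁ z₂ ξ : ℂ} (h₁ : z₁ ∈ disc) (h₂ : z₂ ∈ disc)
    (hξ : ξ ∈ disc) (hne : z₁ ≠ z₂) (e₁ : f z₁ = 0) (e₂ : f z₂ = 0)
    (h : phi ξ z₂ = -phi ξ z₁) : 1 - Real.sqrt C * Real.sqrt (1 - ‖ξ‖) ≤ ‖phi ξ z₁‖ := by
  by_contra! hlt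
  set s := Real.sqrt C * Real.sqrt (1 - ‖ξ‖) with hs
  have hξ1 : 0 < 1 - ‖ξ‖ := by linarith [mem_disc.1 hξ]
  have hs2 : s ^ 2 = C * (1 - ‖ξ‖) := by
    rw [hs, mul_pow, Real.sq_sqrt hC.le, Real.sq_sqrt hξ1.le]
  have hs0 : 0 < s := by positivity
  have hud := phi_mem_disc hξ h₁
  have hu0 : phi ξ z₁ ≠ 0 := by
    intro h0
    rw [h0, neg_zero] at h
    exact hne (by rw [← phi_phi hξ h₁, ← phi_phi hξ h₂, h0, h])
  set u := phi ξ z₁ with hu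
  set t := ‖u‖ with ht
  have ht0 : 0 < t := norm_pos_iff.2 hu0
  -- `t < R` keeps the comparison solution positive on `[-t, t]`, while `R < 1 - s` gives the
  -- condition `s² < (1 - R)²` of `comparison_inequality`.
  obtain ⟨R, htR, hRs⟩ := exists_between hlt
  set g := pullSol f ξ with hg
  obtain ⟨hga, hge⟩ : IsSolution (pullCoeff A ξ) g := isSolution_pullSol hf hξ
  set ζ : ℂ := u / t with hζ
  have htc : (t : ℂ) ≠ 0 := by exact_mod_cast ht0.ne'
  have hζ1 : ‖ζ‖ = 1 := by
    rw [hζ, norm_div, Complex.norm_real, Real.norm_eq_abs, abs_of_pos ht0, ← ht,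
      div_self ht0.ne']
  have hnorm : ∀ x : ℝ, ‖ζ * x‖ = |x| := by
    intro x; rw [norm_mul, hζ1, one_mul, Complex.norm_real, Real.norm_eq_abs]
  have hxt : ∀ x ∈ Set.Icc (-t) t, ζ * x ∈ disc := by
    intro x hx
    rw [mem_disc, hnorm]
    exact (abs_le.2 hx).trans_lt (mem_disc.1 hud)
  have hlin : ∀ x : ℝ, HasDerivAt (fun x : ℝ => ζ * (x : ℂ)) ζ x := by
    intro x
    simpa using (Complex.ofRealCLM.hasDerivAt (x := x)).const_mul ζ
  have hG := eq_zero_of_norm_coeff_lt (R := R) (t := t) ht0 htR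
    (G := fun x => g (ζ * x)) (G' := fun x => deriv g (ζ * x) * ζ)
    (q := fun x => ζ ^ 2 * pullCoeff A ξ (ζ * x))
    (fun x hx => HasDerivAt.comp x (h₂ := g) (hga _ (hxt x hx)).differentiableAt.hasDerivAt (hlin x))
    (fun x hx => by
      refine ((HasDerivAt.comp x (h₂ := deriv g)
        (hga.deriv _ (hxt x hx)).differentiableAt.hasDerivAt (hlin x)).mul_const ζ).congr_deriv ?_
      rw [eq_neg_of_add_eq_zero_left (hge _ (hxt x hx))]
      ring)
    (fun x hx => by
      have hd := hxt x hx
      have hb := norm_pullCoeff_mul (A := A) hξ hd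
      have hb2 := hA _ (phi_mem_disc hξ hd)
      have hb3 := one_sub_norm_phi_le hξ hd
      rw [← hb, hnorm, sq_abs] at hb2
      rw [hnorm] at hb3
      have hx1 : |x| ≤ t := abs_le.2 hx
      have ht1 : t < 1 := mem_disc.1 hud
      have hx2 : 0 < 1 - x ^ 2 := by
        rw [← sq_abs]; nlinarith [abs_nonneg x]
      have hcmp := comparison_inequality (K := s ^ 2) (R := R) (t := |x|) (by positivity)
        (abs_nonneg x) (by linarith) (by linarith) (by nlinarith)
      rw [norm_mul, norm_pow, hζ1, one_pow, one_mul]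
      rw [sq_abs] at hcmp
      refine lt_of_le_of_lt ?_ hcmp
      rw [le_div_iff₀ (by positivity)]
      refine hb2.trans ?_
      rw [hs2]
      have := mul_le_mul_of_nonneg_left hb3 hC.le
      calc 1 + C * (1 - ‖phi ξ (ζ * x)‖) ≤ 1 + C * ((1 - ‖ξ‖) * (1 + |x|) / (1 - |x|)) := by
            linarith
        _ = _ := by ring)
    (by
      have : ζ * ((-t : ℝ) : ℂ) = -u := by rw [hζ]; push_cast; field_simp
      simp only [this]
      rw [← h, hg, pullSol, phi_phi hξ h₂, e₂, zero_mul])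
    (by
      have : ζ * (t : ℂ) = u := by rw [hζ]; field_simp
      simp only [this]
      rw [hg, pullSol, hu, phi_phi hξ h₁, e₁, zero_mul])
  -- The pulled-back solution vanishes on a segment through `0`, so by the identity theorem it
  -- vanishes on the disc.
  obtain ⟨w, hw, hw0⟩ := nonTrivial_pullSol hn hξ
  refine hw0 (hga.eqOn_zero_of_preconnected_of_frequently_eq_zero
    (convex_ball (0 : ℂ) 1).isPreconnected zero_mem_disc ?_ hw)
  have hlim : Tendsto (fun x : ℝ => ζ * (x : ℂ)) (𝓝[>] 0) (𝓝[≠] 0) := by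
    refine tendsto_nhdsWithin_iff.2 ⟨?_, ?_⟩
    · have : Tendsto (fun x : ℝ => ζ * (x : ℂ)) (𝓝 0) (𝓝 (ζ * ((0 : ℝ) : ℂ))) :=
        (hlin 0).continuousAt
      rw [Complex.ofReal_zero, mul_zero] at this
      exact this.mono_left nhdsWithin_le_nhds
    · filter_upwards [self_mem_nhdsWithin] with x hx
      have hx0 : x ≠ 0 := ne_of_gt hx
      have hζ0 : ζ ≠ 0 := by rw [← norm_pos_iff, hζ1]; norm_num
      simp [hx0, hζ0]
  refine hlim.frequently (Eventually.frequently ?_)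
  filter_upwards [Ioo_mem_nhdsGT ht0] with x hx
  exact hG x ⟨by linarith [hx.1], hx.2⟩

/-- At `t = 1 - s` the two logarithms coincide, so the hyperbolic separation bound is a Euclidean
one after centring at the midpoint. -/
theorem log_ratio_le_iff {s t : ℝ} (hs : 0 < s) (hs1 : s < 1) (ht : 0 ≤ t) (ht1 : t < 1) :
    Real.log ((2 - s) / s) ≤ Real.log ((1 + t) / (1 - t)) ↔ 1 - s ≤ t := by
  have h := log_ratio_strictMonoOn.le_iff_le (a := 1 - s) (b := t) ⟨by linarith, by linarith⟩
    ⟨ht, ht1⟩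
  rw [← h]
  have : (1 + (1 - s)) / (1 - (1 - s)) = (2 - s) / s := by ring_nf
  rw [this]

theorem sqrt_mul_sqrt_lt_one {C x : ℝ} (hC : 0 < C) (h : x < 1 / C) :
    Real.sqrt C * Real.sqrt x < 1 := by
  rw [← Real.sqrt_mul hC.le, Real.sqrt_lt' one_pos, one_pow, mul_comm]
  exact (lt_div_iff₀ hC).1 h

theorem zerosSeparated_of_norm_coeff_le {A : ℂ → ℂ} {C : ℝ} (hC : 0 < C)
    (hA : ∀ z ∈ disc, ‖A z‖ * (1 - ‖z‖ ^ 2) ^ 2 ≤ 1 + C * (1 - ‖z‖)) : ZerosSeparated A C := by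
  intro f hf hn z₁ h₁ z₂ h₂ hne e₁ e₂ ξ hmid hξC
  have h := phi_eq_neg_of_isHypMidpoint h₁ h₂ hmid
  have hξ := hmid.1
  have hξ1 : 0 < 1 - ‖ξ‖ := by linarith [mem_disc.1 hξ]
  rw [hypDist_of_phi_eq_neg h₁ h₂ hξ h, log_ratio_le_iff (by positivity)
    (sqrt_mul_sqrt_lt_one hC hξC) (norm_nonneg _) (mem_disc.1 (phi_mem_disc hξ h₁))]
  exact le_norm_phi_of_zeros hC hA hf hn h₁ h₂ hξ hne e₁ e₂ h

end Oscillation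

/-! ### Solving the initial value problem by power series. -/

namespace Oscillation

/-- The sum of the power series with coefficients `c`. -/
noncomputable def powerSum (c : ℕ → ℂ) (z : ℂ) : ℂ := ∑' n, c n * z ^ n

/-- The power series with coefficients `c` converges absolutely in the unit disc. -/
def ConvergesInDisc (c : ℕ → ℂ) : Prop := ∀ r : ℝ, 0 ≤ r → r < 1 → Summable fun n => ‖c n‖ * r ^ n

/-- The coefficients of the derivative of a power series. -/
noncomputable def derivCoeff (c : ℕ → ℂ) (n : ℕ) : ℂ := c (n + 1) * (n + 1)

theorem convergesInDisc_of_summable {c : ℕ → ℂ}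
    (h : ∀ z ∈ disc, Summable fun n => c n * z ^ n) : ConvergesInDisc c := by
  intro r hr0 hr1
  have := (h (r : ℂ) (by rw [mem_disc, Complex.norm_real, Real.norm_eq_abs, abs_of_nonneg hr0]
                         exact hr1)).norm
  simpa [abs_of_nonneg hr0] using this

theorem convergesInDisc_of_bounded {c : ℕ → ℂ}
    (h : ∀ r : ℝ, 0 < r → r < 1 → ∃ K, ∀ n, ‖c n‖ * r ^ n ≤ K) : ConvergesInDisc c := by
  intro r hr0 hr1
  obtain ⟨q, hq, hq1⟩ := exists_between hr1
  have hq0 : 0 < q := by linarith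
  obtain ⟨K, hK⟩ := h q hq0 hq1
  refine Summable.of_nonneg_of_le (fun n => by positivity) (fun n => ?_)
    ((summable_geometric_of_lt_one (div_nonneg hr0 hq0.le) ((div_lt_one hq0).2 hq)).mul_left K)
  have : ‖c n‖ * r ^ n = ‖c n‖ * q ^ n * (r / q) ^ n := by
    rw [div_pow]; field_simp
  rw [this]
  exact mul_le_mul_of_nonneg_right (hK n) (by positivity)

theorem ConvergesInDisc.summable_norm {c : ℕ → ℂ} (h : ConvergesInDisc c) {z : ℂ} (hz : z ∈ disc) :
    Summable fun n => ‖c n * z ^ n‖ := by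
  simpa using h ‖z‖ (norm_nonneg z) (mem_disc.1 hz)

theorem ConvergesInDisc.bounded {c : ℕ → ℂ} (h : ConvergesInDisc c) {r : ℝ} (h0 : 0 ≤ r)
    (h1 : r < 1) : ∃ M, ∀ n, ‖c n‖ * r ^ n ≤ M := by
  refine ⟨_, fun n => (h r h0 h1).le_tsum n fun j _ => by positivity⟩

theorem ConvergesInDisc.differentiableAt_and_hasSum_deriv {c : ℕ → ℂ} (h : ConvergesInDisc c) {z : ℂ}
    (hz : z ∈ disc) : DifferentiableAt ℂ (powerSum c) z ∧
      HasSum (fun n => derivCoeff c n * z ^ n) (deriv (powerSum c) z) := by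
  obtain ⟨r, hzr, hr1⟩ := exists_between (mem_disc.1 hz)
  have hr0 : 0 ≤ r := (norm_nonneg z).trans hzr.le
  have hu := h r hr0 hr1
  have hd : ∀ n : ℕ, DifferentiableOn ℂ (fun w : ℂ => c n * w ^ n) (Metric.ball 0 r) :=
    fun n => by fun_prop
  have hle : ∀ (n : ℕ) (w : ℂ), w ∈ Metric.ball (0 : ℂ) r → ‖c n * w ^ n‖ ≤ ‖c n‖ * r ^ n := by
    intro n w hw
    rw [norm_mul, norm_pow]
    have : ‖w‖ ≤ r := by simpa using (mem_ball_zero_iff.1 hw).le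
    gcongr
  have hzb : z ∈ Metric.ball (0 : ℂ) r := by simpa using hzr
  refine ⟨(Complex.differentiableOn_tsum_of_summable_norm hu hd Metric.isOpen_ball
    hle).differentiableAt (Metric.isOpen_ball.mem_nhds hzb), ?_⟩
  have hs := Complex.hasSum_deriv_of_summable_norm hu hd Metric.isOpen_ball hle hzb
  -- The term of index `0` has derivative zero; dropping it gives the shift in `derivCoeff`.
  have hs' := (hasSum_nat_add_iff' 1).2 hs
  simp only [Finset.range_one, Finset.sum_singleton, pow_zero, mul_one, deriv_const,
    sub_zero] at hs'
  have hfun : (fun n => derivCoeff c n * z ^ n)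
      = fun n => deriv (fun w : ℂ => c (n + 1) * w ^ (n + 1)) z := by
    funext n
    rw [deriv_const_mul_field, deriv_pow_field, derivCoeff]
    push_cast
    ring
  rw [hfun]
  exact hs'

theorem ConvergesInDisc.derivCoeff {c : ℕ → ℂ} (h : ConvergesInDisc c) :
    ConvergesInDisc (derivCoeff c) :=
  convergesInDisc_of_summable fun _ hz => (h.differentiableAt_and_hasSum_deriv hz).2.summable

theorem ConvergesInDisc.hasDerivAt {c : ℕ → ℂ} (h : ConvergesInDisc c) {z : ℂ}
    (hz : z ∈ disc) : HasDerivAt (powerSum c) (powerSum (Oscillation.derivCoeff c) z) z := by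
  obtain ⟨h1, h2⟩ := h.differentiableAt_and_hasSum_deriv hz
  rw [powerSum, h2.tsum_eq]
  exact h1.hasDerivAt

theorem powerSum_zero (c : ℕ → ℂ) : powerSum c 0 = c 0 := by
  rw [powerSum, tsum_eq_single 0 (fun n hn => by simp [hn])]
  simp

/-- The Taylor coefficients of the solution of `f'' + A f = 0`, `f 0 = α`, `f' 0 = β`, where `a` are
the Taylor coefficients of `A`. -/
noncomputable def solCoeff (a : ℕ → ℂ) (α β : ℂ) : ℕ → ℂ
  | 0 => α
  | 1 => β
  | n + 2 => -(∑ k : Fin (n + 1), solCoeff a α β k * a (n - k)) / ((n + 2) * (n + 1))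
decreasing_by exact Nat.lt_succ_of_lt k.2

theorem solCoeff_add_two (a : ℕ → ℂ) (α β : ℂ) (n : ℕ) :
    solCoeff a α β (n + 2)
      = -(∑ k ∈ Finset.range (n + 1), solCoeff a α β k * a (n - k)) / ((n + 2) * (n + 1)) := by
  rw [solCoeff, Finset.sum_range]

theorem convergesInDisc_solCoeff {a : ℕ → ℂ} (ha : ConvergesInDisc a) (α β : ℂ) :
    ConvergesInDisc (solCoeff a α β) := by
  refine convergesInDisc_of_bounded fun r hr0 hr1 => ?_
  obtain ⟨M, hM⟩ := ha.bounded hr0.le hr1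
  have hM0 : 0 ≤ M := by
    refine le_trans ?_ (hM 0)
    positivity
  -- In the recursion the Cauchy product contributes at most `(m + 1) K M` against the denominator
  -- `(m + 2)(m + 1)`. Once `m ≥ N ≥ M` the bound `K` reproduces itself, so it need only dominate
  -- the first `N + 2` terms.
  obtain ⟨N, hN⟩ := exists_nat_ge M
  set c := solCoeff a α β
  set K := ∑ j ∈ Finset.range (N + 2), ‖c j‖ * r ^ j with hK
  refine ⟨K, fun n => ?_⟩
  induction n using Nat.strong_induction_on with
  | _ n ih =>
    by_cases hn : n < N + 2
    · exact Finset.single_le_sum (f := fun j => ‖c j‖ * r ^ j) (fun j _ => by positivity)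
        (Finset.mem_range.2 hn)
    · obtain ⟨m, rfl⟩ : ∃ m, n = m + 2 := ⟨n - 2, by omega⟩
      have hmN : (N : ℝ) ≤ m := by exact_mod_cast (by omega : N ≤ m)
      have hK0 : 0 ≤ K := Finset.sum_nonneg fun j _ => by positivity
      have hsum : ‖∑ k ∈ Finset.range (m + 1), c k * a (m - k)‖ * r ^ m ≤ (m + 1) * (K * M) := by
        calc ‖∑ k ∈ Finset.range (m + 1), c k * a (m - k)‖ * r ^ m
            ≤ (∑ k ∈ Finset.range (m + 1), ‖c k * a (m - k)‖) * r ^ m := by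
              gcongr; exact norm_sum_le _ _
          _ = ∑ k ∈ Finset.range (m + 1), (‖c k‖ * r ^ k) * (‖a (m - k)‖ * r ^ (m - k)) := by
              rw [Finset.sum_mul]
              refine Finset.sum_congr rfl fun k hk => ?_
              have hkm : k ≤ m := Nat.lt_succ_iff.1 (Finset.mem_range.1 hk)
              have : r ^ m = r ^ k * r ^ (m - k) := by rw [← pow_add, Nat.add_sub_cancel' hkm]
              rw [norm_mul, this]
              ring
          _ ≤ ∑ k ∈ Finset.range (m + 1), K * M := by
              refine Finset.sum_le_sum fun k hk => ?_
              have hkm : k < m + 1 := Finset.mem_range.1 hk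
              exact mul_le_mul (ih k (by omega)) (hM _) (by positivity) hK0
          _ = (m + 1) * (K * M) := by simp
      have hden : ‖((m : ℂ) + 2) * (m + 1)‖ = ((m : ℝ) + 2) * (m + 1) := by
        have : ((m : ℂ) + 2) * (m + 1) = (((m + 2) * (m + 1) : ℕ) : ℂ) := by push_cast; ring
        rw [this, Complex.norm_natCast]
        push_cast
        ring
      have hrec : c (m + 2) = -(∑ k ∈ Finset.range (m + 1), c k * a (m - k)) /
          (((m : ℂ) + 2) * (m + 1)) := solCoeff_add_two a α β m
      rw [hrec, norm_div, norm_neg, hden, div_mul_eq_mul_div, div_le_iff₀ (by positivity)]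
      calc ‖∑ k ∈ Finset.range (m + 1), c k * a (m - k)‖ * r ^ (m + 2)
          = (‖∑ k ∈ Finset.range (m + 1), c k * a (m - k)‖ * r ^ m) * r ^ 2 := by ring
        _ ≤ ((m + 1) * (K * M)) * 1 := by
            gcongr
            exact pow_le_one₀ hr0.le hr1.le
        _ = K * (M * (m + 1)) := by ring
        _ ≤ K * ((m + 2) * (m + 1)) := by
            gcongr
            linarith

/-- The initial value problem for `f'' + A f = 0` is solvable in the whole disc. -/
theorem exists_isSolution {A : ℂ → ℂ} (hA : AnalyticOnNhd ℂ A disc) (α β : ℂ) :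
    ∃ f, IsSolution A f ∧ f 0 = α ∧ deriv f 0 = β := by
  set a : ℕ → ℂ := fun n => (n.factorial : ℂ)⁻¹ * iteratedDeriv n A 0 with ha
  have hsum : ∀ z ∈ disc, HasSum (fun n => a n * z ^ n) (A z) := by
    intro z hz
    have := Complex.hasSum_taylorSeries_on_ball hA.differentiableOn hz
    have hfun : (fun n => a n * z ^ n)
        = fun n : ℕ => (n.factorial : ℂ)⁻¹ • (z - 0) ^ n • iteratedDeriv n A 0 := by
      funext n
      simp only [ha, smul_eq_mul, sub_zero]
      ring
    rwa [hfun]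
  have hac : ConvergesInDisc a := convergesInDisc_of_summable fun z hz => (hsum z hz).summable
  have hc := convergesInDisc_solCoeff hac α β
  set c := solCoeff a α β with hcdef
  have hd1 : ∀ z ∈ disc, HasDerivAt (powerSum c) (powerSum (derivCoeff c) z) z :=
    fun z hz => hc.hasDerivAt hz
  have hd2 : ∀ z ∈ disc, HasDerivAt (deriv (powerSum c))
      (powerSum (derivCoeff (derivCoeff c)) z) z := by
    intro z hz
    refine (hc.derivCoeff.hasDerivAt hz).congr_of_eventuallyEq ?_
    filter_upwards [isOpen_disc.mem_nhds hz] with w hw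
    exact (hd1 w hw).deriv
  refine ⟨powerSum c, ⟨DifferentiableOn.analyticOnNhd
    (fun z hz => (hd1 z hz).differentiableAt.differentiableWithinAt) isOpen_disc,
    fun z hz => ?_⟩, ?_, ?_⟩
  · rw [(hd2 z hz).deriv, ← (hsum z hz).tsum_eq, mul_comm, powerSum, powerSum,
      tsum_mul_tsum_eq_tsum_sum_range_of_summable_norm (hc.summable_norm hz)
        (hac.summable_norm hz), add_eq_zero_iff_eq_neg, ← tsum_neg]
    refine tsum_congr fun n => ?_
    have hterm : ∑ k ∈ Finset.range (n + 1), c k * z ^ k * (a (n - k) * z ^ (n - k))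
        = (∑ k ∈ Finset.range (n + 1), c k * a (n - k)) * z ^ n := by
      rw [Finset.sum_mul]
      refine Finset.sum_congr rfl fun k hk => ?_
      have hkm : k ≤ n := Nat.lt_succ_iff.1 (Finset.mem_range.1 hk)
      have : z ^ n = z ^ k * z ^ (n - k) := by rw [← pow_add, Nat.add_sub_cancel' hkm]
      rw [this]
      ring
    have h1 : ((n : ℂ) + 2) ≠ 0 := by exact_mod_cast (by omega : n + 2 ≠ 0)
    have h2 : ((n : ℂ) + 1) ≠ 0 := by exact_mod_cast (by omega : n + 1 ≠ 0)
    rw [hterm, derivCoeff, derivCoeff, hcdef, solCoeff_add_two]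
    push_cast
    field_simp
    ring
  · rw [powerSum_zero, hcdef, solCoeff]
  · rw [(hd1 0 zero_mem_disc).deriv, powerSum_zero, derivCoeff, hcdef, solCoeff]
    simp

end Oscillation

/-! ### The area theorem. -/

namespace Oscillation

open ComplexConjugate MeasureTheory Real

theorem polarCoord_symm_eq_circleMap (p : ℝ × ℝ) :
    Complex.polarCoord.symm p = circleMap 0 p.1 p.2 := by
  rw [Complex.polarCoord_symm_apply, circleMap, Complex.exp_mul_I]
  simp

theorem integral_Ioo_circleMap (g : ℂ → ℝ) (τ : ℝ) :
    ∫ θ in Set.Ioo (-π) π, g (circleMap 0 τ θ) = 2 * π * circleAverage g 0 τ := by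
  rw [circleAverage_eq_integral_add (-π),
    intervalIntegral.integral_comp_add_right (fun θ => g (circleMap 0 τ θ)),
    ← integral_Ioc_eq_integral_Ioo, ← intervalIntegral.integral_of_le (by linarith [pi_pos])]
  have : 2 * π + -π = π := by ring
  rw [zero_add, this, smul_eq_mul, ← mul_assoc, mul_inv_cancel₀ (by positivity), one_mul]

/-- Integration over an annulus in polar coordinates. -/
theorem integral_annulus {g : ℂ → ℝ} {r s : ℝ} (hr : 0 < r)
    (hg : ContinuousOn g {z | r ≤ ‖z‖ ∧ ‖z‖ ≤ s}) :
    ∫ z in {z : ℂ | r < ‖z‖ ∧ ‖z‖ < s}, g z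
      = ∫ τ in Set.Ioo r s, τ * (2 * π * circleAverage g 0 τ) := by
  have hE : MeasurableSet {z : ℂ | r < ‖z‖ ∧ ‖z‖ < s} :=
    (measurableSet_lt measurable_const measurable_norm).inter
      (measurableSet_lt measurable_norm measurable_const)
  rw [← integral_indicator hE, ← Complex.integral_comp_polarCoord_symm]
  have hcont : ContinuousOn (fun p : ℝ × ℝ => p.1 * g (circleMap 0 p.1 p.2))
      (Set.Icc r s ×ˢ Set.Icc (-π) π) := by
    refine continuousOn_fst.mul (hg.comp ?_ ?_)
    · simp only [circleMap]
      fun_prop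
    · rintro p ⟨hp, -⟩
      have : 0 ≤ p.1 := hr.le.trans hp.1
      simp only [Set.mem_ofPred_eq, norm_circleMap_zero, abs_of_nonneg this]
      exact hp
  have hint : IntegrableOn (fun p : ℝ × ℝ => p.1 * g (circleMap 0 p.1 p.2))
      (Set.Ioo r s ×ˢ Set.Ioo (-π) π) (volume.prod volume) :=
    (hcont.integrableOn_compact (isCompact_Icc.prod isCompact_Icc)).mono_set
      (Set.prod_mono Set.Ioo_subset_Icc_self Set.Ioo_subset_Icc_self)
  have heq : ∫ p in polarCoord.target, p.1 •
        ({z : ℂ | r < ‖z‖ ∧ ‖z‖ < s}.indicator g (Complex.polarCoord.symm p))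
      = ∫ p in Set.Ioo r s ×ˢ Set.Ioo (-π) π, p.1 * g (circleMap 0 p.1 p.2) := by
    rw [← integral_indicator polarCoord.open_target.measurableSet,
      ← integral_indicator (measurableSet_Ioo.prod measurableSet_Ioo)]
    congr 1
    funext p
    simp only [Set.indicator, polarCoord_target, Set.mem_prod, Set.mem_Ioi, Set.mem_ofPred_eq,
      Set.mem_Ioo, smul_eq_mul, polarCoord_symm_eq_circleMap]
    by_cases h1 : -π < p.2 ∧ p.2 < π
    · by_cases h2 : 0 < p.1
      · simp [h1, h2, abs_of_pos h2]
      · have : ¬ (r < p.1) := by linarith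
        simp [h2, this]
    · simp [h1]
  rw [heq, Measure.volume_eq_prod, setIntegral_prod _ hint]
  refine setIntegral_congr_fun measurableSet_Ioo fun τ _ => ?_
  simp only
  rw [integral_const_mul, integral_Ioo_circleMap]

theorem det_mulLeft_complex (c : ℂ) :
    ((ContinuousLinearMap.toSpanSingleton ℂ c).restrictScalars ℝ).det = ‖c‖ ^ 2 := by
  rw [Complex.sq_norm, ← Algebra.norm_complex_apply, ContinuousLinearMap.det]
  have : (((ContinuousLinearMap.toSpanSingleton ℂ c).restrictScalars ℝ : ℂ →L[ℝ] ℂ) : ℂ →ₗ[ℝ] ℂ)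
      = Algebra.lmul ℝ ℂ c := by
    ext
    simp [mul_comm]
  rw [this, Algebra.norm_apply]

/-- The area of the image of an injective holomorphic map. -/
theorem volume_real_image {F F' : ℂ → ℂ} {E : Set ℂ} (hE : MeasurableSet E)
    (hF : ∀ z ∈ E, HasDerivAt F (F' z) z) (hinj : Set.InjOn F E) :
    volume.real (F '' E) = ∫ z in E, ‖F' z‖ ^ 2 := by
  have h := integral_image_eq_integral_abs_det_fderiv_smul volume hE
    (f' := fun z => (ContinuousLinearMap.toSpanSingleton ℂ (F' z)).restrictScalars ℝ)
    (fun z hz => ((hF z hz).hasFDerivAt.restrictScalars ℝ).hasFDerivWithinAt) hinj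
    (fun _ => (1 : ℝ))
  simp only [det_mulLeft_complex, smul_eq_mul, mul_one, abs_pow, abs_norm] at h
  rw [← h]
  simp

/-- The real linear map `w ↦ w - c * conj w`. -/
noncomputable def subMulConj (c : ℂ) : ℂ →ₗ[ℝ] ℂ :=
  LinearMap.id - (Algebra.lmul ℝ ℂ c) ∘ₗ Complex.conjAe.toLinearMap

theorem subMulConj_apply (c w : ℂ) : subMulConj c w = w - c * conj w := by
  simp [subMulConj]

theorem det_subMulConj (c : ℂ) : LinearMap.det (subMulConj c) = 1 - ‖c‖ ^ 2 := by
  rw [← LinearMap.det_toMatrix Complex.basisOneI, Matrix.det_fin_two, Complex.sq_norm,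
    Complex.normSq_apply]
  simp [LinearMap.toMatrix_apply, subMulConj_apply]
  ring

/-- A mean value estimate on circles for the derivative of `1 / z + H(z)`, where `h = H'`. -/
theorem le_circleAverage_norm_sq {h : ℂ → ℂ} {ρ τ : ℝ} (hh : DifferentiableOn ℂ h (Metric.ball 0 ρ))
    (hτ : 0 < τ) (hτρ : τ < ρ) :
    (τ ^ 4)⁻¹ + ‖h 0‖ ^ 2 ≤ circleAverage (fun z => ‖-(z ^ 2)⁻¹ + h z‖ ^ 2) 0 τ := by
  -- On `|z| = τ` one has `z⁻² = τ⁻⁴ conj(z²)`, so the cross term is the real part of a holomorphic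
  -- function; `|h|²` is bounded below by its tangent at `h 0`. Thus `Re Q` is a minorant, and its
  -- mean is `Q 0`.
  set Q : ℂ → ℂ := fun z =>
    ((τ ^ 4)⁻¹ + ‖h 0‖ ^ 2 : ℝ) + (-2 * ((τ ^ 4)⁻¹ : ℝ) * (z ^ 2 * h z)
      + 2 * (conj (h 0) * (h z - h 0))) with hQ
  have hsub : Metric.closedBall (0 : ℂ) τ ⊆ Metric.ball 0 ρ := Metric.closedBall_subset_ball hτρ
  have hhc : DifferentiableOn ℂ h (Metric.closedBall 0 τ) := hh.mono hsub
  have hQd : DifferentiableOn ℂ Q (Metric.closedBall 0 τ) := by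
    rw [hQ]; fun_prop
  have hsph : Metric.sphere (0 : ℂ) |τ| ⊆ Metric.closedBall 0 τ := by
    rw [abs_of_pos hτ]; exact Metric.sphere_subset_closedBall
  have hQc : circleAverage Q 0 τ = Q 0 := by
    apply DiffContOnCl.circleAverage
    rw [abs_of_pos hτ]
    exact DifferentiableOn.diffContOnCl_ball hQd subset_rfl
  have hQi : CircleIntegrable Q 0 τ := (hQd.continuousOn.mono hsph).circleIntegrable'
  have hre : circleAverage (fun z => (Q z).re) 0 τ = (τ ^ 4)⁻¹ + ‖h 0‖ ^ 2 := by
    have := Complex.reCLM.circleAverage_comp_comm hQi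
    have h2 : (Complex.reCLM ∘ Q) = fun z => (Q z).re := rfl
    rw [h2, hQc] at this
    rw [this]
    have h3 : Q 0 = (((τ ^ 4)⁻¹ + ‖h 0‖ ^ 2 : ℝ) : ℂ) := by simp [hQ]
    rw [h3, Complex.reCLM_apply, Complex.ofReal_re]
  rw [← hre]
  refine circleAverage_mono ?_ ?_ ?_
  · exact (Complex.continuous_re.comp_continuousOn (hQd.continuousOn.mono hsph)).circleIntegrable'
  · refine ContinuousOn.circleIntegrable' ?_
    have : ContinuousOn h (Metric.sphere 0 |τ|) := hhc.continuousOn.mono hsph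
    refine ((ContinuousOn.inv₀ (by fun_prop) fun z hz => ?_).neg.add this).norm.pow 2
    have : z ≠ 0 := by
      rintro rfl
      rw [mem_sphere_zero_iff_norm, norm_zero] at hz
      exact (abs_pos.2 hτ.ne').ne hz
    positivity
  · intro z hz
    have hzτ : ‖z‖ = τ := by simpa [abs_of_pos hτ] using hz
    have hz0 : z ≠ 0 := by rw [← norm_pos_iff, hzτ]; exact hτ
    have hinv : (z ^ 2)⁻¹ = ((τ ^ 4)⁻¹ : ℝ) * conj (z ^ 2) := by
      rw [Complex.inv_def, Complex.normSq_eq_norm_sq, norm_pow, hzτ, mul_comm]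
      congr 3
      ring
    have e1 : ‖-(z ^ 2)⁻¹ + h z‖ ^ 2
        = (τ ^ 4)⁻¹ - 2 * (τ ^ 4)⁻¹ * (z ^ 2 * h z).re + ‖h z‖ ^ 2 := by
      have h1 : ‖-(z ^ 2)⁻¹‖ ^ 2 = (τ ^ 4)⁻¹ := by
        rw [norm_neg, norm_inv, norm_pow, hzτ, inv_pow]; ring_nf
      have h2 : inner ℝ (-(z ^ 2)⁻¹) (h z) = -((τ ^ 4)⁻¹ * (z ^ 2 * h z).re) := by
        rw [Complex.inner, hinv, map_neg, map_mul, Complex.conj_conj, Complex.conj_ofReal,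
          mul_neg, Complex.neg_re, mul_left_comm, mul_comm (h z), Complex.re_ofReal_mul]
      rw [norm_add_sq_real, h1, h2]
      ring
    have e2 : ‖h 0‖ ^ 2 + 2 * (conj (h 0) * (h z - h 0)).re ≤ ‖h z‖ ^ 2 := by
      have h3 := norm_add_sq_real (h 0) (h z - h 0)
      rw [Complex.inner, add_sub_cancel, mul_comm (h z - h 0)] at h3
      rw [h3]
      have := sq_nonneg ‖h z - h 0‖
      linarith
    have e3 : (Q z).re = (τ ^ 4)⁻¹ + ‖h 0‖ ^ 2 + (-2 * (τ ^ 4)⁻¹ * (z ^ 2 * h z).re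
        + 2 * (conj (h 0) * (h z - h 0)).re) := by
      have q1 : Q z = (((τ ^ 4)⁻¹ + ‖h 0‖ ^ 2 : ℝ) : ℂ)
          + (((-2 * (τ ^ 4)⁻¹ : ℝ) : ℂ) * (z ^ 2 * h z)
          + ((2 : ℝ) : ℂ) * (conj (h 0) * (h z - h 0))) := by
        rw [hQ]; push_cast; ring
      rw [q1, Complex.add_re, Complex.add_re, Complex.re_ofReal_mul, Complex.re_ofReal_mul,
        Complex.ofReal_re]
    rw [e1, e3]
    linarith

theorem integral_radial {r s β : ℝ} (hr : 0 < r) (hrs : r ≤ s) :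
    ∫ τ in Set.Ioo r s, τ * (2 * π * ((τ ^ 4)⁻¹ + β))
      = π * ((r ^ 2)⁻¹ - (s ^ 2)⁻¹ + β * (s ^ 2 - r ^ 2)) := by
  rw [← integral_Ioc_eq_integral_Ioo, ← intervalIntegral.integral_of_le hrs]
  have hne : ∀ x ∈ Set.uIcc r s, x ≠ 0 := by
    intro x hx
    rw [Set.uIcc_of_le hrs] at hx
    linarith [hx.1]
  have hd : ∀ x ∈ Set.uIcc r s, HasDerivAt (fun x => π * (-(x ^ 2)⁻¹ + β * x ^ 2))
      (x * (2 * π * ((x ^ 4)⁻¹ + β))) x := by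
    intro x hx
    have hx0 := hne x hx
    have h1 := (hasDerivAt_pow 2 x).fun_inv (pow_ne_zero 2 hx0)
    refine ((h1.neg.add ((hasDerivAt_pow 2 x).const_mul β)).const_mul π).congr_deriv ?_
    field_simp
    ring
  rw [intervalIntegral.integral_eq_sub_of_hasDerivAt hd]
  · ring
  · refine ContinuousOn.intervalIntegrable ?_
    refine continuousOn_id.mul (continuousOn_const.mul (ContinuousOn.add ?_ continuousOn_const))
    exact ContinuousOn.inv₀ (by fun_prop) fun x hx => pow_ne_zero 4 (hne x hx)

/-- The image of an annulus under `z ↦ 1 / z + H(z)` lies in an ellipse. -/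
theorem norm_subMulConj_le {b z e : ℂ} {r s M₀ : ℝ} (hr : 0 < r) (hz : r ≤ ‖z‖) (hzs : ‖z‖ ≤ s)
    (hM₀ : 0 ≤ M₀) (he : ‖e‖ ≤ M₀ * ‖z‖ ^ 2)
    (hsmall : r * (2 * s * ‖b‖ + 2 * s ^ 2 * (M₀ + ‖b‖ ^ 2 * s + ‖b‖ * s ^ 2 * M₀)) ≤ 1) :
    ‖subMulConj (b * r ^ 2) (z⁻¹ + (b * z + e))‖
      ≤ r⁻¹ + (M₀ + ‖b‖ ^ 2 * s + ‖b‖ * s ^ 2 * M₀) * r ^ 2 := by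
  have hτ : 0 < ‖z‖ := hr.trans_le hz
  have hz0 : z ≠ 0 := norm_pos_iff.1 hτ
  have hs : 0 < s := hτ.trans_le hzs
  -- The conjugate of `z⁻¹` is `z/|z|²`, so the term `b z` acquires the factor `1 - r²/|z|²`, which
  -- vanishes on the inner circle. This cancellation leaves an error `O(r²)` in the radius instead
  -- of `O(r)`.
  have hdec : subMulConj (b * r ^ 2) (z⁻¹ + (b * z + e))
      = z⁻¹ + ((1 - r ^ 2 / ‖z‖ ^ 2 : ℝ) : ℂ) * (b * z) + e - b * r ^ 2 * conj (b * z + e) := by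
    have hc : conj z⁻¹ = z / ‖z‖ ^ 2 := by
      have hcz : conj z ≠ 0 := by simpa using hz0
      rw [map_inv₀, ← Complex.conj_mul']
      field_simp
    rw [subMulConj_apply, map_add, hc]
    push_cast
    ring
  rw [hdec]
  set τ := ‖z‖ with hτd
  set M := M₀ + ‖b‖ ^ 2 * s + ‖b‖ * s ^ 2 * M₀ with hM
  have hM0 : 0 ≤ M := by positivity
  have hq : 0 ≤ 1 - r ^ 2 / τ ^ 2 := by
    rw [sub_nonneg, div_le_one (by positivity)]
    gcongr
  have t1 : ‖((1 - r ^ 2 / τ ^ 2 : ℝ) : ℂ) * (b * z)‖ = (1 - r ^ 2 / τ ^ 2) * (‖b‖ * τ) := by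
    rw [norm_mul, norm_mul, Complex.norm_real, Real.norm_eq_abs, abs_of_nonneg hq]
  have t2 : ‖b * r ^ 2 * conj (b * z + e)‖ ≤ ‖b‖ * r ^ 2 * (‖b‖ * τ + M₀ * τ ^ 2) := by
    rw [norm_mul, norm_mul, Complex.norm_conj, norm_pow, Complex.norm_real, Real.norm_eq_abs,
      sq_abs]
    gcongr
    refine (norm_add_le _ _).trans ?_
    rw [norm_mul]
    gcongr
  have t3 : ‖b‖ * r ^ 2 * (‖b‖ * τ + M₀ * τ ^ 2) ≤ (‖b‖ ^ 2 * s + ‖b‖ * s ^ 2 * M₀) * τ ^ 2 := by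
    have u1 : ‖b‖ ^ 2 * (r ^ 2 * τ) ≤ ‖b‖ ^ 2 * (τ ^ 2 * s) := by gcongr
    have u2 : ‖b‖ * M₀ * (r ^ 2 * τ ^ 2) ≤ ‖b‖ * M₀ * (s ^ 2 * τ ^ 2) := by
      gcongr
      exact hz.trans hzs
    linarith
  -- For small `r` the majorant on `τ ≥ r` is largest at `τ = r`; `hsmall` makes the last factor in
  -- `e1` nonnegative.
  have t4 : τ⁻¹ + (1 - r ^ 2 / τ ^ 2) * (‖b‖ * τ) + M * τ ^ 2 ≤ r⁻¹ + M * r ^ 2 := by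
    have e1 : r⁻¹ + M * r ^ 2 - (τ⁻¹ + (1 - r ^ 2 / τ ^ 2) * (‖b‖ * τ) + M * τ ^ 2)
        = (τ - r) / (r * τ) * (1 - r * ((τ + r) * ‖b‖ + τ * (τ + r) * M)) := by
      field_simp
      ring
    have e2 : r * ((τ + r) * ‖b‖ + τ * (τ + r) * M) ≤ r * (2 * s * ‖b‖ + 2 * s ^ 2 * M) := by
      have v1 : τ + r ≤ 2 * s := by linarith
      have v2 : τ * (τ + r) ≤ 2 * s ^ 2 := by
        calc τ * (τ + r) ≤ s * (2 * s) := by gcongr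
          _ = 2 * s ^ 2 := by ring
      gcongr
    have e3 : 0 ≤ (τ - r) / (r * τ) * (1 - r * ((τ + r) * ‖b‖ + τ * (τ + r) * M)) := by
      refine mul_nonneg (div_nonneg (by linarith) (by positivity)) ?_
      linarith
    linarith
  calc ‖z⁻¹ + ((1 - r ^ 2 / τ ^ 2 : ℝ) : ℂ) * (b * z) + e - b * r ^ 2 * conj (b * z + e)‖
      ≤ ‖z⁻¹‖ + ‖((1 - r ^ 2 / τ ^ 2 : ℝ) : ℂ) * (b * z)‖ + ‖e‖
        + ‖b * r ^ 2 * conj (b * z + e)‖ := by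
        refine (norm_sub_le _ _).trans ?_
        gcongr
        refine (norm_add_le _ _).trans ?_
        gcongr
        exact norm_add_le _ _
    _ ≤ τ⁻¹ + (1 - r ^ 2 / τ ^ 2) * (‖b‖ * τ) + M * τ ^ 2 := by
        rw [norm_inv, t1]
        rw [hM]
        linarith
    _ ≤ _ := t4

theorem exists_second_order_bound {H : ℂ → ℂ} {ρ s : ℝ} (hρ : 0 < ρ) (hsρ : s < ρ)
    (hH : DifferentiableOn ℂ H (Metric.ball 0 ρ)) (h0 : H 0 = 0) :
    ∃ M₀, 0 ≤ M₀ ∧ ∀ z : ℂ, ‖z‖ ≤ s → ‖H z - deriv H 0 * z‖ ≤ M₀ * ‖z‖ ^ 2 := by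
  have hnhds : Metric.ball (0 : ℂ) ρ ∈ 𝓝 0 := Metric.ball_mem_nhds 0 hρ
  have hk : DifferentiableOn ℂ (dslope (dslope H 0) 0) (Metric.ball 0 ρ) :=
    (Complex.differentiableOn_dslope hnhds).2 ((Complex.differentiableOn_dslope hnhds).2 hH)
  obtain ⟨K, hK⟩ := (isCompact_closedBall (0 : ℂ) s).exists_bound_of_continuousOn
    (hk.continuousOn.mono (Metric.closedBall_subset_ball hsρ))
  refine ⟨max K 0, le_max_right _ _, fun z hz => ?_⟩
  have e1 := sub_smul_dslope H 0 z
  have e2 := sub_smul_dslope (dslope H 0) 0 z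
  rw [dslope_same] at e2
  simp only [sub_zero, smul_eq_mul, h0] at e1 e2
  have : H z - deriv H 0 * z = dslope (dslope H 0) 0 z * z ^ 2 := by
    rw [← e1]
    linear_combination (-z) * e2
  rw [this, norm_mul, norm_pow]
  gcongr
  exact (hK z (by simpa using hz)).trans (le_max_left _ _)

/-- The area theorem: the coefficient `b` of a univalent function `1 / z + b z + ⋯` in the punctured
disc of radius `ρ` satisfies `|b| ρ² ≤ 1`. -/
theorem norm_deriv_mul_sq_le_one {H : ℂ → ℂ} {ρ : ℝ} (hρ : 0 < ρ)
    (hH : DifferentiableOn ℂ H (Metric.ball 0 ρ)) (h0 : H 0 = 0)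
    (hinj : Set.InjOn (fun z => z⁻¹ + H z) (Metric.ball 0 ρ \ {0})) :
    ‖deriv H 0‖ * ρ ^ 2 ≤ 1 := by
  set b := deriv H 0 with hb
  have hmain : ∀ s, 0 < s → s < ρ → ‖b‖ * s ^ 2 ≤ 1 := by
    intro s hs hsρ
    obtain ⟨M₀, hM₀, hbound⟩ := exists_second_order_bound hρ hsρ hH h0
    set M := M₀ + ‖b‖ ^ 2 * s + ‖b‖ * s ^ 2 * M₀ with hM
    have hH' : DifferentiableOn ℂ (deriv H) (Metric.ball 0 ρ) := hH.deriv Metric.isOpen_ball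
    -- The left side bounds the area of the image of `r < |z| < s` from below, using injectivity and
    -- circle means, multiplied by the determinant of `subMulConj`; the right side is the area of a
    -- disc containing the transformed image. An inclusion suffices, so the boundary curve need not
    -- be studied.
    have harea : ∀ r, 0 < r → r < s → r * (2 * s * ‖b‖ + 2 * s ^ 2 * M) ≤ 1 → ‖b‖ * r ^ 2 < 1 →
        π * ((r ^ 2)⁻¹ - (s ^ 2)⁻¹ + ‖b‖ ^ 2 * (s ^ 2 - r ^ 2)) * (1 - ‖b‖ ^ 2 * r ^ 4)
          ≤ π * (r⁻¹ + M * r ^ 2) ^ 2 := by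
      intro r hr hrs hsmall hbr
      set E : Set ℂ := {z | r < ‖z‖ ∧ ‖z‖ < s} with hE
      have hEm : MeasurableSet E := (measurableSet_lt measurable_const measurable_norm).inter
        (measurableSet_lt measurable_norm measurable_const)
      have hsubE : E ⊆ Metric.ball 0 ρ \ {0} := by
        rintro z ⟨h1, h2⟩
        refine ⟨by simpa using h2.trans hsρ, ?_⟩
        rintro rfl
        rw [norm_zero] at h1
        linarith
      have hder : ∀ z ∈ E, HasDerivAt (fun z => z⁻¹ + H z) (-(z ^ 2)⁻¹ + deriv H z) z := by
        intro z hz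
        exact (hasDerivAt_inv (hsubE hz).2).add
          ((hH.differentiableAt (Metric.isOpen_ball.mem_nhds (hsubE hz).1)).hasDerivAt)
      have hvol := volume_real_image hEm hder (hinj.mono hsubE)
      have hcont : ContinuousOn (fun z => ‖-(z ^ 2)⁻¹ + deriv H z‖ ^ 2)
          {z | r ≤ ‖z‖ ∧ ‖z‖ ≤ s} := by
        refine ((ContinuousOn.inv₀ (by fun_prop) fun z hz => ?_).neg.add
          (hH'.continuousOn.mono fun z hz => ?_)).norm.pow 2
        · exact pow_ne_zero 2 (norm_pos_iff.1 (hr.trans_le hz.1))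
        · simpa using hz.2.trans_lt hsρ
      have hlower : π * ((r ^ 2)⁻¹ - (s ^ 2)⁻¹ + ‖b‖ ^ 2 * (s ^ 2 - r ^ 2))
          ≤ volume.real ((fun z => z⁻¹ + H z) '' E) := by
        rw [hvol, integral_annulus hr hcont, ← integral_radial hr hrs.le]
        have hav : ContinuousOn (circleAverage (fun z => ‖-(z ^ 2)⁻¹ + deriv H z‖ ^ 2) 0)
            (Set.Icc r s) := by
          refine ContinuousOn.circleAverage ?_ fun x hx => hr.le.trans hx.1
          simpa using hcont
        refine setIntegral_mono_on ?_ ?_ measurableSet_Ioo fun τ hτ => ?_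
        · refine (ContinuousOn.integrableOn_Icc ?_).mono_set Set.Ioo_subset_Icc_self
          refine continuousOn_id.mul (continuousOn_const.mul
            (ContinuousOn.add ?_ continuousOn_const))
          exact ContinuousOn.inv₀ (by fun_prop) fun x hx =>
            pow_ne_zero 4 (hr.trans_le hx.1).ne'
        · refine (ContinuousOn.integrableOn_Icc ?_).mono_set Set.Ioo_subset_Icc_self
          exact continuousOn_id.mul (continuousOn_const.mul hav)
        · have hτ0 : 0 < τ := hr.trans hτ.1
          have := le_circleAverage_norm_sq hH' hτ0 (hτ.2.trans hsρ)
          gcongr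
      have hdet : LinearMap.det (subMulConj (b * r ^ 2)) = 1 - ‖b‖ ^ 2 * r ^ 4 := by
        rw [det_subMulConj, norm_mul, norm_pow, Complex.norm_real, Real.norm_eq_abs, sq_abs]
        ring
      have hdetpos : 0 ≤ 1 - ‖b‖ ^ 2 * r ^ 4 := by
        have : 0 ≤ ‖b‖ * r ^ 2 := by positivity
        nlinarith
      have hball : subMulConj (b * r ^ 2) '' ((fun z => z⁻¹ + H z) '' E)
          ⊆ Metric.closedBall 0 (r⁻¹ + M * r ^ 2) := by
        rintro _ ⟨_, ⟨z, hz, rfl⟩, rfl⟩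
        have := norm_subMulConj_le (b := b) (e := H z - b * z) hr hz.1.le hz.2.le hM₀
          (hbound z hz.2.le) hsmall
        rw [add_sub_cancel] at this
        simpa using this
      have hM0 : 0 ≤ M := by positivity
      have hupper : volume.real ((fun z => z⁻¹ + H z) '' E) * (1 - ‖b‖ ^ 2 * r ^ 4)
          ≤ π * (r⁻¹ + M * r ^ 2) ^ 2 := by
        have h1 := measureReal_mono (μ := volume) hball measure_closedBall_lt_top.ne
        rw [measureReal_def, Measure.addHaar_image_linearMap, hdet, abs_of_nonneg hdetpos,
          ENNReal.toReal_mul, ENNReal.toReal_ofReal hdetpos, measureReal_def,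
          Complex.volume_closedBall, ENNReal.toReal_mul, ENNReal.toReal_pow,
          ENNReal.toReal_ofReal (by positivity)] at h1
        simp only [ENNReal.coe_toReal, NNReal.coe_real_pi] at h1
        rw [measureReal_def]
        linarith
      exact (mul_le_mul_of_nonneg_right hlower hdetpos).trans hupper
    have hlim : ‖b‖ ^ 2 * s ^ 2 - (s ^ 2)⁻¹ ≤ 0 := by
      -- `f` collects the terms that remain once `r⁻²` has cancelled from both sides of `harea`; all
      -- of them tend to `0` with `r`.
      set f : ℝ → ℝ := fun r => 2 * M * r + M ^ 2 * r ^ 4 + 2 * ‖b‖ ^ 2 * r ^ 2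
        + ‖b‖ ^ 2 * r ^ 4 * (-(s ^ 2)⁻¹ + ‖b‖ ^ 2 * (s ^ 2 - r ^ 2)) with hf
      have hfc : Tendsto f (𝓝[>] 0) (𝓝 0) := by
        have : Continuous f := by rw [hf]; fun_prop
        have h1 := this.tendsto 0
        have h2 : f 0 = 0 := by simp [hf]
        rw [h2] at h1
        exact h1.mono_left nhdsWithin_le_nhds
      have hev1 : ∀ᶠ r : ℝ in 𝓝[>] 0, r * (2 * s * ‖b‖ + 2 * s ^ 2 * M) < 1 := by
        have : Continuous fun r : ℝ => r * (2 * s * ‖b‖ + 2 * s ^ 2 * M) := by fun_prop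
        exact ((this.tendsto 0).mono_left nhdsWithin_le_nhds).eventually_lt_const (by simp)
      have hev2 : ∀ᶠ r : ℝ in 𝓝[>] 0, ‖b‖ * r ^ 2 < 1 := by
        have : Continuous fun r : ℝ => ‖b‖ * r ^ 2 := by fun_prop
        exact ((this.tendsto 0).mono_left nhdsWithin_le_nhds).eventually_lt_const (by simp)
      refine ge_of_tendsto hfc ?_
      filter_upwards [hev1, hev2, Ioo_mem_nhdsGT hs] with r h1 h2 h3
      have hr := h3.1
      have h4 := harea r hr h3.2 h1.le h2
      rw [mul_assoc] at h4
      have h5 := le_of_mul_le_mul_left h4 pi_pos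
      have e1 : (r ^ 2)⁻¹ * r ^ 4 = r ^ 2 := by field_simp
      have e2 : (r⁻¹ + M * r ^ 2) ^ 2 = (r ^ 2)⁻¹ + 2 * M * r + M ^ 2 * r ^ 4 := by
        field_simp
        ring
      rw [e2] at h5
      rw [hf]
      simp only
      have e3 : ((r ^ 2)⁻¹ - (s ^ 2)⁻¹ + ‖b‖ ^ 2 * (s ^ 2 - r ^ 2)) * (1 - ‖b‖ ^ 2 * r ^ 4)
          = (r ^ 2)⁻¹ - (s ^ 2)⁻¹ + ‖b‖ ^ 2 * (s ^ 2 - r ^ 2) - ‖b‖ ^ 2 * r ^ 2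
            - ‖b‖ ^ 2 * r ^ 4 * (-(s ^ 2)⁻¹ + ‖b‖ ^ 2 * (s ^ 2 - r ^ 2)) := by
        linear_combination (-‖b‖ ^ 2) * e1
      rw [e3] at h5
      linarith
    have hsq : (‖b‖ * s ^ 2) ^ 2 ≤ 1 := by
      have h1 : ‖b‖ ^ 2 * s ^ 2 ≤ (s ^ 2)⁻¹ := by linarith
      have h2 := mul_le_mul_of_nonneg_right h1 (sq_nonneg s)
      rw [inv_mul_cancel₀ (by positivity)] at h2
      calc (‖b‖ * s ^ 2) ^ 2 = ‖b‖ ^ 2 * s ^ 2 * s ^ 2 := by ring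
        _ ≤ 1 := h2
    exact (abs_le_one_iff_mul_self_le_one.2 (by nlinarith)).trans' (le_abs_self _)
  have hlim : Tendsto (fun s : ℝ => ‖b‖ * s ^ 2) (𝓝[<] ρ) (𝓝 (‖b‖ * ρ ^ 2)) := by
    have : Continuous fun s : ℝ => ‖b‖ * s ^ 2 := by fun_prop
    exact (this.tendsto ρ).mono_left nhdsWithin_le_nhds
  refine le_of_tendsto hlim ?_
  filter_upwards [Ioo_mem_nhdsLT hρ] with s hs
  exact hmain s hs.1 hs.2

end Oscillation

/-! ### Univalent quotients of solutions, and the converse growth estimate. -/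

namespace Oscillation

open ComplexConjugate

theorem deriv_mul_eventuallyEq {u v : ℂ → ℂ} {z : ℂ} (hu : AnalyticAt ℂ u z)
    (hv : AnalyticAt ℂ v z) :
    deriv (fun w => u w * v w) =ᶠ[𝓝 z] fun w => deriv u w * v w + u w * deriv v w := by
  filter_upwards [hu.eventually_analyticAt, hv.eventually_analyticAt] with w h1 h2
  exact deriv_fun_mul h1.differentiableAt h2.differentiableAt

theorem deriv_deriv_mul {u v : ℂ → ℂ} {z : ℂ} (hu : AnalyticAt ℂ u z) (hv : AnalyticAt ℂ v z) :
    deriv (deriv fun w => u w * v w) z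
      = deriv (deriv u) z * v z + 2 * (deriv u z * deriv v z) + u z * deriv (deriv v) z := by
  rw [(deriv_mul_eventuallyEq hu hv).deriv_eq,
    deriv_fun_add (hu.deriv.fun_mul hv).differentiableAt (hu.fun_mul hv.deriv).differentiableAt,
    deriv_fun_mul hu.deriv.differentiableAt hv.differentiableAt,
    deriv_fun_mul hu.differentiableAt hv.deriv.differentiableAt]
  ring

theorem deriv_deriv_id_mul {v : ℂ → ℂ} {z : ℂ} (hv : AnalyticAt ℂ v z) :
    deriv (deriv fun w => w * v w) z = 2 * deriv v z + z * deriv (deriv v) z := by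
  have h := deriv_deriv_mul (u := fun w => w) analyticAt_id hv
  have h1 : deriv (fun w : ℂ => w) = fun _ => 1 := by funext w; exact deriv_id w
  rw [h, h1]
  simp

theorem deriv_id_mul_zero {v : ℂ → ℂ} (hv : AnalyticAt ℂ v 0) :
    deriv (fun w => w * v w) 0 = v 0 := by
  rw [deriv_fun_mul differentiableAt_fun_id hv.differentiableAt]
  simp

theorem nonTrivial_of_deriv_ne_zero {g : ℂ → ℂ} (h : deriv g 0 ≠ 0) : NonTrivial g := by
  by_contra hn
  simp only [NonTrivial, not_exists, not_and, not_not] at hn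
  refine h ?_
  have : g =ᶠ[𝓝 0] fun _ => 0 := by
    filter_upwards [isOpen_disc.mem_nhds zero_mem_disc] with z hz using hn z hz
  rw [this.deriv_eq, deriv_const]

theorem IsSolution.sub_const_mul {A f g : ℂ → ℂ} (hf : IsSolution A f) (hg : IsSolution A g)
    (c : ℂ) : IsSolution A fun z => f z - c * g z := by
  have hd : ∀ z ∈ disc, deriv (fun z => f z - c * g z) z = deriv f z - c * deriv g z := by
    intro z hz
    rw [deriv_fun_sub (hf.1 z hz).differentiableAt ((hg.1 z hz).differentiableAt.const_mul c),
      deriv_const_mul_field]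
  refine ⟨hf.1.sub (analyticOnNhd_const.mul hg.1), fun z hz => ?_⟩
  have he : deriv (fun z => f z - c * g z) =ᶠ[𝓝 z] fun z => deriv f z - c * deriv g z := by
    filter_upwards [isOpen_disc.mem_nhds hz] with w hw using hd w hw
  rw [he.deriv_eq, deriv_fun_sub (hf.1.deriv z hz).differentiableAt
    ((hg.1.deriv z hz).differentiableAt.const_mul c), deriv_const_mul_field]
  linear_combination hf.2 z hz - c * hg.2 z hz

/-- If every non-trivial solution has at most one zero in the disc of radius `ρ`, the quotient of
two independent solutions is univalent there, and the area theorem bounds the coefficient at the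
centre. -/
theorem norm_coeff_zero_le {B : ℂ → ℂ} (hB : AnalyticOnNhd ℂ B disc) {ρ : ℝ} (hρ : 0 < ρ)
    (hρ1 : ρ ≤ 1) (huniq : ∀ g, IsSolution B g → NonTrivial g →
      ∀ u ∈ Metric.ball (0 : ℂ) ρ, ∀ v ∈ Metric.ball (0 : ℂ) ρ, g u = 0 → g v = 0 → u = v) :
    ‖B 0‖ * ρ ^ 2 ≤ 3 := by
  obtain ⟨f₁, s₁, v₁, d₁⟩ := exists_isSolution hB 0 1
  obtain ⟨f₂, s₂, v₂, d₂⟩ := exists_isSolution hB 1 0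
  have hsub : Metric.ball (0 : ℂ) ρ ⊆ disc := Metric.ball_subset_ball hρ1
  have h0 : (0 : ℂ) ∈ Metric.ball (0 : ℂ) ρ := Metric.mem_ball_self hρ
  have hn : Metric.ball (0 : ℂ) ρ ∈ 𝓝 0 := Metric.ball_mem_nhds 0 hρ
  have hf₁ : ∀ z ∈ Metric.ball (0 : ℂ) ρ, z ≠ 0 → f₁ z ≠ 0 := fun z hz hz0 h =>
    hz0 (huniq f₁ s₁ (nonTrivial_of_deriv_ne_zero (by rw [d₁]; exact one_ne_zero)) z hz 0 h0 h v₁)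
  -- Dividing out the simple zero of `f₁` gives `f₁ = z k`. With `P = f₂ / k = 1 + z H`, the
  -- quotient `f₂ / f₁` is `1/z + H`, with `H(0) = 0` and `H'(0) = P''(0)/2 = -B(0)/3`.
  set k := dslope f₁ 0 with hk
  have hkd : DifferentiableOn ℂ k (Metric.ball 0 ρ) :=
    (Complex.differentiableOn_dslope hn).2 (s₁.1.differentiableOn.mono hsub)
  have hk0 : k 0 = 1 := by rw [hk, dslope_same, d₁]
  have hfk : ∀ z, f₁ z = z * k z := by
    intro z
    have := sub_smul_dslope f₁ 0 z
    simpa [v₁] using this.symm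
  have hkne : ∀ z ∈ Metric.ball (0 : ℂ) ρ, k z ≠ 0 := by
    intro z hz hkz
    by_cases hz0 : z = 0
    · rw [hz0, hk0] at hkz
      exact one_ne_zero hkz
    · exact hf₁ z hz hz0 (by rw [hfk, hkz, mul_zero])
  set P : ℂ → ℂ := fun z => f₂ z / k z with hP
  have hPd : DifferentiableOn ℂ P (Metric.ball 0 ρ) :=
    (s₂.1.differentiableOn.mono hsub).div hkd hkne
  have hP0 : P 0 = 1 := by simp [hP, v₂, hk0]
  set H := dslope P 0 with hH
  have hHd : DifferentiableOn ℂ H (Metric.ball 0 ρ) := (Complex.differentiableOn_dslope hn).2 hPd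
  have hPH : ∀ z, P z = 1 + z * H z := by
    intro z
    have := sub_smul_dslope P 0 z
    rw [hP0, sub_zero, smul_eq_mul] at this
    rw [hH, this]
    ring
  have ka : AnalyticAt ℂ k 0 := hkd.analyticAt hn
  have Pa : AnalyticAt ℂ P 0 := hPd.analyticAt hn
  have Ha : AnalyticAt ℂ H 0 := hHd.analyticAt hn
  have Ba : AnalyticAt ℂ B 0 := hB 0 zero_mem_disc
  have hf₁fun : f₁ = fun z => z * k z := funext hfk
  -- second order expansion of `k`
  have hode : ∀ᶠ z in 𝓝 (0 : ℂ), 2 * deriv k z + z * deriv (deriv k) z = -(z * (B z * k z)) := by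
    filter_upwards [ka.eventually_analyticAt, isOpen_disc.mem_nhds zero_mem_disc] with z h1 h2
    have := s₁.2 z h2
    rw [hf₁fun, deriv_deriv_id_mul h1] at this
    linear_combination this
  have hk1 : deriv k 0 = 0 := by
    have := hode.self_of_nhds
    simpa using this
  have hk2 : deriv (deriv k) 0 = -B 0 / 3 := by
    have hd := EventuallyEq.deriv_eq hode
    have e1 : deriv (fun z => 2 * deriv k z + z * deriv (deriv k) z) 0
        = 2 * deriv (deriv k) 0 + deriv (deriv k) 0 := by
      rw [deriv_fun_add (ka.deriv.differentiableAt.const_mul 2)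
        (differentiableAt_fun_id.fun_mul ka.deriv.deriv.differentiableAt), deriv_const_mul_field,
        deriv_id_mul_zero ka.deriv.deriv]
    have e2 : deriv (fun z => -(z * (B z * k z))) 0 = -(B 0 * k 0) := by
      rw [deriv.fun_neg, deriv_id_mul_zero (Ba.fun_mul ka)]
    rw [e1, e2, hk0] at hd
    linear_combination hd / 3
  -- second order expansion of `P`
  have hf₂ : f₂ =ᶠ[𝓝 0] fun z => k z * P z := by
    filter_upwards [hn] with z hz
    have := hkne z hz
    simp only [hP]
    field_simp
  have hP1 : deriv P 0 = 0 := by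
    have h1 := hf₂.deriv_eq
    rw [d₂, deriv_fun_mul ka.differentiableAt Pa.differentiableAt, hk1, hk0] at h1
    simpa using h1.symm
  have hP2 : deriv (deriv P) 0 = -2 * B 0 / 3 := by
    have h1 := hf₂.deriv.deriv_eq
    rw [deriv_deriv_mul ka Pa, hk1, hk2, hP0, hk0] at h1
    have h2 := s₂.2 0 zero_mem_disc
    rw [v₂, h1] at h2
    linear_combination h2
  have hH0 : H 0 = 0 := by rw [hH, dslope_same, hP1]
  have hH1 : deriv H 0 = -B 0 / 3 := by
    have h1 : P = fun z => 1 + z * H z := funext hPH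
    have h2 : deriv P = deriv fun z => z * H z := by
      rw [h1]; funext z; exact deriv_const_add 1
    rw [h2, deriv_deriv_id_mul Ha] at hP2
    linear_combination hP2 / 2
  have hquot : ∀ z ∈ Metric.ball (0 : ℂ) ρ \ {0}, z⁻¹ + H z = f₂ z / f₁ z := by
    rintro z ⟨hz, hz0⟩
    have hz0' : z ≠ 0 := hz0
    have h1 := hkne z hz
    have h2 : f₂ z = k z * (1 + z * H z) := by
      rw [← hPH]; simp only [hP]; field_simp
    rw [h2, hfk]
    field_simp
  have hinj : Set.InjOn (fun z => z⁻¹ + H z) (Metric.ball 0 ρ \ {0}) := by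
    intro z hz w hw hzw
    simp only at hzw
    rw [hquot z hz, hquot w hw] at hzw
    have hz1 := hf₁ z hz.1 hz.2
    have hw1 := hf₁ w hw.1 hw.2
    -- If the quotient takes the value `c` at both points, then `f₂ - c f₁` vanishes at both, and it
    -- equals `1` at the origin.
    refine huniq _ (s₂.sub_const_mul s₁ (f₂ w / f₁ w)) ⟨0, zero_mem_disc, by simp [v₁, v₂]⟩
      z hz.1 w hw.1 ?_ ?_
    · rw [← hzw]; field_simp; ring
    · field_simp; ring
  have := norm_deriv_mul_sq_le_one hρ hHd hH0 hinj
  rw [hH1, norm_div, norm_neg] at this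
  norm_num at this
  linarith

/-- The exponent `3` comes from balancing: within the disc of radius `1 - 2y`, `C(1 - |ξ|) ≤ C(1 -
|a|)/y = y²`. Separation then requires `‖phi ξ z₁‖ ≥ 1 - y`, whereas convexity gives `‖phi ξ z₁‖ < 1
- 2y`. -/
theorem not_two_zeros_in_hypBall {A f : ℂ → ℂ} {C y : ℝ} (hC : 0 < C) (hA : ZerosSeparated A C)
    (hf : IsSolution A f) (hn : NonTrivial f) {a z₁ z₂ : ℂ} (ha : a ∈ disc) (h₁ : z₁ ∈ disc)
    (h₂ : z₂ ∈ disc) (hy : 0 < y) (hy1 : y < 1) (hyC : y ^ 3 = C * (1 - ‖a‖)) (e₁ : f z₁ = 0)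
    (e₂ : f z₂ = 0) (d₁ : ‖phi a z₁‖ < 1 - 2 * y) (d₂ : ‖phi a z₂‖ < 1 - 2 * y) : z₁ = z₂ := by
  by_contra hne
  obtain ⟨ξ, hξ, h⟩ := exists_phi_eq_neg h₁ h₂
  obtain ⟨b1, b2⟩ := midpoint_mem_hypBall h₁ h₂ hξ ha h (by linarith) d₁ d₂
  have hξ1 : 0 < 1 - ‖ξ‖ := by linarith [mem_disc.1 hξ]
  have ha1 : 0 < 1 - ‖a‖ := by linarith [mem_disc.1 ha]
  have hle := one_sub_norm_phi_le ha (phi_mem_disc ha hξ)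
  rw [phi_phi ha hξ] at hle
  have hle2 : 1 - ‖ξ‖ ≤ (1 - ‖a‖) * 2 / (2 * y) := by
    refine hle.trans ?_
    gcongr <;> linarith
  have hCξ : C * (1 - ‖ξ‖) ≤ y ^ 2 := by
    calc C * (1 - ‖ξ‖) ≤ C * ((1 - ‖a‖) * 2 / (2 * y)) := by gcongr
      _ = C * (1 - ‖a‖) / y := by field_simp
      _ = y ^ 2 := by rw [← hyC]; field_simp
  have hξC : 1 - ‖ξ‖ < 1 / C := by
    rw [lt_div_iff₀ hC]
    nlinarith
  have hs : Real.sqrt C * Real.sqrt (1 - ‖ξ‖) ≤ y := by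
    rw [← Real.sqrt_mul hC.le]
    exact (Real.sqrt_le_sqrt hCξ).trans_eq (Real.sqrt_sq hy.le)
  have hsep := hA f hf hn z₁ h₁ z₂ h₂ hne e₁ e₂ ξ (isHypMidpoint_of_phi_eq_neg h₁ h₂ hξ h) hξC
  rw [hypDist_of_phi_eq_neg h₁ h₂ hξ h, log_ratio_le_iff (by positivity)
    (sqrt_mul_sqrt_lt_one hC hξC) (norm_nonneg _) (mem_disc.1 (phi_mem_disc hξ h₁))] at hsep
  linarith

theorem norm_coeff_mul_le_of_zerosSeparated {A : ℂ → ℂ} {C y : ℝ} (hC : 0 < C)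
    (hAn : AnalyticOnNhd ℂ A disc) (hA : ZerosSeparated A C) {a : ℂ} (ha : a ∈ disc) (hy : 0 < y)
    (hy1 : 2 * y < 1) (hyC : y ^ 3 = C * (1 - ‖a‖)) :
    ‖A a‖ * (1 - ‖a‖ ^ 2) ^ 2 * (1 - 2 * y) ^ 2 ≤ 3 := by
  have h0 := norm_pullCoeff_mul (A := A) ha zero_mem_disc
  simp only [phi_zero, norm_zero] at h0
  norm_num at h0
  rw [← h0]
  refine norm_coeff_zero_le (analyticOnNhd_pullCoeff hAn ha) (by linarith) (by linarith)
    fun g hg hgn u hu v hv eu ev => ?_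
  rw [mem_ball_zero_iff] at hu hv
  have hud : u ∈ disc := mem_disc.2 (by linarith)
  have hvd : v ∈ disc := mem_disc.2 (by linarith)
  -- As `phi a` is an involution, pulling `g` back once more returns to the original equation.
  have hf : IsSolution A (pullSol g a) := by
    obtain ⟨p1, p2⟩ := isSolution_pullSol hg ha
    refine ⟨p1, fun z hz => ?_⟩
    have := p2 z hz
    rwa [pullCoeff_pullCoeff ha hz] at this
  have key := not_two_zeros_in_hypBall (y := y) hC hA hf (nonTrivial_pullSol hgn ha) ha
    (phi_mem_disc ha hud) (phi_mem_disc ha hvd) hy (by linarith) hyC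
    (by rw [pullSol, phi_phi ha hud, eu, zero_mul]) (by rw [pullSol, phi_phi ha hvd, ev, zero_mul])
    (by rwa [phi_phi ha hud]) (by rwa [phi_phi ha hvd])
  rw [← phi_phi ha hud, key, phi_phi ha hvd]

/-- The function `Ψ_C` of the converse growth estimate. -/
noncomputable def growthBound (C r : ℝ) : ℝ :=
  let c := (8 * C) ^ (1 / 3 : ℝ)
  let x := c * (1 - r) ^ (1 / 3 : ℝ)
  -- The first branch makes `1 + Ψ (1 - r)^(1/3)` equal to `1/(1 - x)²`. The value `1` only secures
  -- positivity: for `r < 1`, `x < 1` is the range `1 - r < 1/(8C)`.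
  if x < 1 then c * ((2 - x) / (1 - x) ^ 2) else 1

theorem growthBound_pos {C : ℝ} (hC : 0 < C) (r : ℝ) : 0 < growthBound C r := by
  simp only [growthBound]
  split_ifs with h
  · have h1 : 0 < 1 - (8 * C) ^ (1 / 3 : ℝ) * (1 - r) ^ (1 / 3 : ℝ) := by linarith
    have h2 : 0 < 2 - (8 * C) ^ (1 / 3 : ℝ) * (1 - r) ^ (1 / 3 : ℝ) := by linarith
    positivity
  · exact one_pos

theorem tendsto_growthBound {C : ℝ} (hC : 0 < C) :
    Tendsto (growthBound C) (𝓝[<] (1 : ℝ)) (𝓝[>] (2 * (8 * C) ^ (1 / 3 : ℝ))) := by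
  set c := (8 * C) ^ (1 / 3 : ℝ) with hc
  have hc0 : 0 < c := by positivity
  have hx : Tendsto (fun r : ℝ => c * (1 - r) ^ (1 / 3 : ℝ)) (𝓝[<] 1) (𝓝 0) := by
    have h1 : ContinuousAt (fun r : ℝ => c * (1 - r) ^ (1 / 3 : ℝ)) 1 := by
      refine continuousAt_const.mul (ContinuousAt.rpow_const (by fun_prop) (Or.inr (by norm_num)))
    have h2 : c * (1 - (1 : ℝ)) ^ (1 / 3 : ℝ) = 0 := by norm_num
    have h3 := h1.tendsto
    rw [h2] at h3
    exact h3.mono_left nhdsWithin_le_nhds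
  have hlt : ∀ᶠ r : ℝ in 𝓝[<] 1, c * (1 - r) ^ (1 / 3 : ℝ) < 1 :=
    hx.eventually_lt_const one_pos
  have heq : (fun r : ℝ => c * ((2 - c * (1 - r) ^ (1 / 3 : ℝ)) /
      (1 - c * (1 - r) ^ (1 / 3 : ℝ)) ^ 2)) =ᶠ[𝓝[<] 1] growthBound C := by
    filter_upwards [hlt] with r hr
    simp only [growthBound]
    rw [← hc, if_pos hr]
  refine tendsto_nhdsWithin_iff.2 ⟨Tendsto.congr' heq ?_, ?_⟩
  · have h1 : ContinuousAt (fun x : ℝ => c * ((2 - x) / (1 - x) ^ 2)) 0 := by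
      refine continuousAt_const.mul (ContinuousAt.div (by fun_prop) (by fun_prop) (by norm_num))
    have h2 : c * ((2 - (0 : ℝ)) / (1 - 0) ^ 2) = 2 * c := by ring
    have h3 := h1.tendsto
    rw [h2] at h3
    exact h3.comp hx
  · filter_upwards [hlt, heq, self_mem_nhdsWithin] with r hr he hr1
    rw [← he]
    have hr2 : 0 < 1 - r := by linarith [Set.mem_Iio.1 hr1]
    set x := c * (1 - r) ^ (1 / 3 : ℝ) with hxd
    have hx0 : 0 < x := by positivity
    have h1 : 0 < 1 - x := by linarith
    -- This strict inequality for `0 < x < 1` is why the limit is approached from above.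
    have h2 : 2 < (2 - x) / (1 - x) ^ 2 := by
      rw [lt_div_iff₀ (by positivity)]
      nlinarith
    rw [Set.mem_Ioi, mul_comm]
    gcongr

theorem le_growthBound {A : ℂ → ℂ} {C : ℝ} (hC : 0 < C) (hAn : AnalyticOnNhd ℂ A disc)
    (hA : ZerosSeparated A C) {z : ℂ} (hz : z ∈ disc) (hzC : 1 - ‖z‖ < (8 * C)⁻¹) :
    ‖A z‖ * (1 - ‖z‖ ^ 2) ^ 2 ≤ 3 * (1 + growthBound C ‖z‖ * (1 - ‖z‖) ^ (1 / 3 : ℝ)) := by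
  have hz1 : 0 < 1 - ‖z‖ := by linarith [mem_disc.1 hz]
  set x := (8 * C) ^ (1 / 3 : ℝ) * (1 - ‖z‖) ^ (1 / 3 : ℝ) with hx
  have hx0 : 0 < x := by positivity
  have hx3 : x ^ 3 = 8 * C * (1 - ‖z‖) := by
    rw [hx, ← Real.mul_rpow (by positivity) hz1.le, ← Real.rpow_natCast, ← Real.rpow_mul
      (by positivity)]
    norm_num
  have hx1 : x < 1 := by
    refine lt_of_pow_lt_pow_left₀ 3 zero_le_one ?_
    rw [hx3, one_pow, mul_comm]
    rwa [← lt_div_iff₀ (by positivity), one_div]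
  have key := norm_coeff_mul_le_of_zerosSeparated (y := x / 2) hC hAn hA hz (by positivity)
    (by linarith) (by rw [div_pow, hx3]; ring)
  have h1 : 0 < 1 - x := by linarith
  have hx2 : 1 - 2 * (x / 2) = 1 - x := by ring
  rw [hx2, ← le_div_iff₀ (by positivity)] at key
  refine key.trans_eq ?_
  have hg : growthBound C ‖z‖ * (1 - ‖z‖) ^ (1 / 3 : ℝ) = x * ((2 - x) / (1 - x) ^ 2) := by
    simp only [growthBound]
    rw [← hx, if_pos hx1]
    nth_rewrite 3 [hx]
    ring
  rw [hg]
  field_simp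
  ring

end Oscillation

theorem mainTheorem2 :
    (∀ A : ℂ → ℂ, AnalyticOnNhd ℂ A Oscillation.disc → ∀ C : ℝ, 0 < C →
      (∀ z ∈ Oscillation.disc, ‖A z‖ * (1 - ‖z‖ ^ 2) ^ 2 ≤ 1 + C * (1 - ‖z‖)) →
      Oscillation.ZerosSeparated A C) ∧
    (∀ C : ℝ, 0 < C → ∃ Ψ : ℝ → ℝ,
      (∀ r ∈ Set.Ico (0 : ℝ) 1, 0 < Ψ r) ∧
      Tendsto Ψ (𝓝[<] (1 : ℝ)) (𝓝[>] (2 * (8 * C) ^ (1 / 3 : ℝ))) ∧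
      ∀ A : ℂ → ℂ, AnalyticOnNhd ℂ A Oscillation.disc → Oscillation.ZerosSeparated A C →
        ∀ z ∈ Oscillation.disc, 1 - ‖z‖ < (8 * C)⁻¹ →
          ‖A z‖ * (1 - ‖z‖ ^ 2) ^ 2 ≤ 3 * (1 + Ψ ‖z‖ * (1 - ‖z‖) ^ (1 / 3 : ℝ))) := by
  refine ⟨fun A _ C hC h => Oscillation.zerosSeparated_of_norm_coeff_le hC h, fun C hC =>
    ⟨Oscillation.growthBound C, fun r _ => Oscillation.growthBound_pos hC r,
      Oscillation.tendsto_growthBound hC, fun A hAn hA z hz hzC =>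
        Oscillation.le_growthBound hC hAn hA hz hzC⟩⟩
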